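/- **Setting.** Vertices $1,\dots,6$ of a convex hexagon are labelled cyclically (indices mod $6$) in counterclockwise order; edge $i$ joins vertices $i,i+1$. A Wilson loop diagram $W$ with $2$ propagators on $6$ vertices is a set of two pairs $p=(i,j)$, $i<j$, where $p$ joins edges $i$ and $j$ and has support $V_p=\{i,i+1,j,j+1\}$. The propagators $p_1,p_2$ are numbered in the order in which they are met on a counterclockwise walk from vertex $1$. $W$ is admissible if no non-empty set $Q$ of its propagators has $|\bigcup_{q\in Q}V_q|<|Q|+3$ and its propagators do not cross. $\mathcal C(W)$ is the $2\times 6$ matrix with entry $(b,a)$ an indeterminate $c_{b,a}$ if $a\in V_{p_b}$ and $0$ otherwise. A positroid cell is a non-empty set of all totally nonnegative points of the real Grassmannian $\mathbb G_{\mathbb R}(2,6)$ with a prescribed set of nonvanishing maximal minors (its bases); it has dimension $d$ if it is diffeomorphic to an open $d$-ball. $\Sigma(W)$ is the closure of the positroid cell whose bases are the not identically zero maximal minors of $\mathcal C(W)$, and $\mathcal W(2,6)=\bigcup_{W\text{ admissible}}\Sigma(W)$. For $v\in V_p$, the boundary diagram $\partial_{p,v}(W)$ is obtained by moving the endpoint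 of $p$ adjacent to $v$ along its edge away from $v$ until it reaches the other vertex of the edge or meets the endpoint of another propagator $q$ (propagators sharing an edge being drawn without crossings). Put $\Delta_{p,v}(W)=c_{p,v}$ in the first case and $\Delta_{p,v}(W)=c_{p,e}c_{q,e+1}-c_{q,e}c_{p,e+1}$ in the second, $e$ being the edge. The cell parametrized by $\partial_{p,v}(W)$ is the positroid cell whose bases are the maximal minors of $\mathcal C(W)$ that do not vanish identically on $\Delta_{p,v}(W)=0$. Let $Z_1,\dots,Z_6\in\mathbb R^{6}$ and $Z_*\in\mathbb R^4\times\{0\}^2$ have indeterminate entries and let $Z^\mu$ denote the first four entries of $Z$. Localization substitutes for the $c_{b,a}$ the solution of $Z_*^\mu+\sum_{a\in V_{p_b}}c_{b,a}Z_a^\mu=0$ $(b=1,2)$. For an edge $e$ with incident propagators $q_1,\dots,q_s$, ordered from vertex $e$ to vertex $e+1$, put $R_e(W)=c_{q_1,e+1}\,c_{q_s,e}\prod_{m=1}^{s-1}(c_{q_m,e}c_{q_{m+1},e+1}-c_{q_{m+1},e}c_{q_m,e+1})$, and let $R(W)$ be the product of $R_e(W)$ over the edges $e$ that carry a propagator.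 The localized integral $\mathcal I(W)(\mathcal Z_*)$ is the rational function of the external data $\mathcal Z_*$ obtained by localizing $\prod_{b=1}^{2}\bigl(\sum_{a\in V_{p_b}}c_{b,a}Z_a^{4+b}\bigr)^4/R(W)$. The minor $\Delta_{p,v}(W)$ is a simple pole of $\mathcal I(W)(\mathcal Z_*)$ if its localization vanishes along some irreducible hypersurface, and $\mathcal I(W)(\mathcal Z_*)$ has a pole of order exactly one along every irreducible hypersurface along which it vanishes. **Proposition.** For a subset $B$ of $\mathbb G_{\mathbb R}(2,6)$ the following are equivalent: (a) $B$ is a $5$-dimensional positroid cell in $\mathcal W(2,6)$, and $B\subseteq\Sigma(W)\cap\Sigma(W')$ for two distinct admissible Wilson loop diagrams $W,W'$ with $2$ propagators on $6$ vertices; (b) there are an admissible diagram $\hat W$ with $2$ propagators on $6$ vertices, a propagator $\hat p$ of $\hat W$ and $\hat v\in V_{\hat p}$ such that (1) $B$ is the cell parametrized by $\partial_{\hat p,\hat v}(\hat W)$, and (2) the minor $\Delta_{\hat p,\hat v}(\hat W)$ is a simple pole of $\mathcal I(\hat W)(\mathcal Z_*)$. The same equivalence holds if in (2) the pole is only required to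 have order one along at least one irreducible hypersurface along which the localization of $\Delta_{\hat p,\hat v}(\hat W)$ vanishes. -/

import Mathlib

open scoped ContDiff

namespace WilsonLoop

noncomputable section

/-! ## Minors, the Grassmannian, positroid cells -/

/-- The maximal minor of a `k × n` matrix on the columns `I 0 < I 1 < ⋯`; the `k`-subsets of the
columns are encoded as order embeddings `Fin k ↪o Fin n`. -/
def minor {R : Type*} [CommRing R] {k n : ℕ} (A : Matrix (Fin k) (Fin n) R)
    (I : Fin k ↪o Fin n) : R :=
  (A.submatrix id I).det

/-- Real `k × n` matrices of full rank `k`. -/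
abbrev FullRank (k n : ℕ) : Type := {A : Matrix (Fin k) (Fin n) ℝ // A.rank = k}

/-- Two full rank matrices are identified when they differ by the left action of `GL_k(ℝ)`. -/
def rowEquiv (k n : ℕ) : Setoid (FullRank k n) where
  r A B := ∃ g : GL (Fin k) ℝ, B.1 = (g : Matrix (Fin k) (Fin k) ℝ) * A.1
  iseqv :=
    { refl := fun _ => ⟨1, by simp⟩
      symm := by
        rintro A B ⟨g, hg⟩
        exact ⟨g⁻¹, by rw [hg, ← Matrix.mul_assoc, ← Units.val_mul]; simp⟩
      trans := by
        rintro A B C ⟨g, hg⟩ ⟨h, hh⟩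
        exact ⟨h * g, by rw [hh, hg, ← Matrix.mul_assoc, Units.val_mul]⟩ }

/-- The real Grassmannian: full rank `k × n` matrices modulo `GL_k(ℝ)`, with the quotient
topology. -/
abbrev Grassmannian (k n : ℕ) : Type := Quotient (rowEquiv k n)

/-- The point of the Grassmannian represented by a full rank matrix. -/
def toGr {k n : ℕ} (A : FullRank k n) : Grassmannian k n := Quotient.mk (rowEquiv k n) A

/-- The set of totally nonnegative points whose nonvanishing maximal minors are exactly those
indexed by `𝓑`. -/
def cell {k n : ℕ} (𝓑 : Set (Fin k ↪o Fin n)) : Set (Grassmannian k n) :=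
  {x | ∃ A : FullRank k n, toGr A = x ∧ (∀ I, 0 ≤ minor A.1 I) ∧ ∀ I, minor A.1 I ≠ 0 ↔ I ∈ 𝓑}

/-- `B` is a positroid cell: `B = cell 𝓑` for a collection `𝓑` that is represented by a totally
nonnegative point. -/
def IsPositroidCell {k n : ℕ} (B : Set (Grassmannian k n)) : Prop :=
  B.Nonempty ∧ ∃ 𝓑 : Set (Fin k ↪o Fin n), B = cell 𝓑

/-- `B` is an open ball of dimension `d`: it is diffeomorphic to `ℝ^d`. The diffeomorphism is given
by a smooth family `φ` of representing matrices, and its inverse by a map `ψ` which is defined and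
smooth near every matrix that represents a point of `B`. -/
def HasDimension {k n : ℕ} (B : Set (Grassmannian k n)) (d : ℕ) : Prop :=
  ∃ (φ : EuclideanSpace ℝ (Fin d) → FullRank k n)
    (ψ : (Fin k → Fin n → ℝ) → EuclideanSpace ℝ (Fin d)),
    (∀ x, toGr (φ x) ∈ B) ∧
    (∀ A : FullRank k n, toGr A ∈ B → ∀ x, ψ (fun i j => A.1 i j) = x ↔ toGr (φ x) = toGr A) ∧
    ContDiff ℝ ∞ (fun x => fun (i : Fin k) (j : Fin n) => (φ x).1 i j) ∧
    ∀ A : FullRank k n, toGr A ∈ B → ContDiffAt ℝ ∞ ψ (fun i j => A.1 i j)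

/-! ## Wilson loop diagrams -/

/-- A Wilson loop diagram with `k` propagators on the `n`-gon. The vertices `1, …, n` are
`0, …, n - 1 : Fin n`, in counterclockwise order, and the edge `i` joins the vertices `i` and
`i + 1` (cyclically). The propagator `prop b = (i, j)`, `i < j`, joins the edges `i` and `j`.
The propagators are listed in the order in which they are first met on a counterclockwise walk from
the first vertex (the propagators that share their first edge `i` are met in the order of
decreasing `j`); so two diagrams are equal exactly when their sets of propagators are. -/
@[ext]
structure Diagram (k n : ℕ) where
  prop : Fin k → Fin n × Fin n
  fst_lt_snd : ∀ b, (prop b).1 < (prop b).2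
  ordered : ∀ b c, b < c →
    (prop b).1 < (prop c).1 ∨ ((prop b).1 = (prop c).1 ∧ (prop c).2 < (prop b).2)

namespace Diagram

variable {k n : ℕ} [NeZero n] (W : Diagram k n)

/-- The vertex support `{i, i + 1, j, j + 1}` of the propagator `b = (i, j)`. -/
def support (b : Fin k) : Finset (Fin n) :=
  {(W.prop b).1, (W.prop b).1 + 1, (W.prop b).2, (W.prop b).2 + 1}

/-- Admissibility: enough vertices, no densely supported set of propagators, no crossings. -/
structure Admissible : Prop where
  size : k + 4 ≤ n
  density : ∀ Q : Finset (Fin k), Q.Nonempty → Q.card + 3 ≤ (Q.biUnion W.support).card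
  noncrossing : ∀ b c, ¬((W.prop b).1 < (W.prop c).1 ∧ (W.prop c).1 < (W.prop b).2 ∧
    (W.prop b).2 < (W.prop c).2)

/-- The polynomial ring in the indeterminates `c_{b,a}`. -/
abbrev CRing (k n : ℕ) : Type := MvPolynomial (Fin k × Fin n) ℝ

/-- The indeterminate `c_{b,a}`. -/
def c (b : Fin k) (a : Fin n) : CRing k n := MvPolynomial.X (b, a)

/-- The matrix `C(W)`: the entry `(b, a)` is `c_{b,a}` if `a` supports `b`, and `0` otherwise. -/
def matC : Matrix (Fin k) (Fin n) (CRing k n) :=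
  fun b a => if a ∈ W.support b then c b a else 0

/-- The bases of the positroid defined by `C(W)`. -/
def bases : Set (Fin k ↪o Fin n) := {I | minor W.matC I ≠ 0}

/-- `Σ(W)`: the closure of the positroid cell of `W`. -/
def Sig : Set (Grassmannian k n) := closure (cell W.bases)

/-! ### Arrangement of the propagators along an edge -/

/-- The propagator `b` ends on the edge `e`. -/
def Incident (e : Fin n) (b : Fin k) : Prop := (W.prop b).1 = e ∨ (W.prop b).2 = e

instance (e : Fin n) (b : Fin k) : Decidable (W.Incident e b) := by
  unfold Incident; infer_instance

/-- For a propagator `b` that ends on the edge `e`: the number of counterclockwise steps from `e` to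
the other edge of `b`. Among the propagators on `e`, drawn without crossings, a propagator is closer
to the vertex `e` (and farther from `e + 1`) the larger this number is. -/
def offset (e : Fin n) (b : Fin k) : Fin n :=
  (if (W.prop b).1 = e then (W.prop b).2 else (W.prop b).1) - e

/-- On the edge `e`, walking from the vertex `e` to the vertex `e + 1`, the propagator `q` comes
immediately after the propagator `b`. -/
def Next (e : Fin n) (b q : Fin k) : Prop :=
  W.Incident e b ∧ W.Incident e q ∧ W.offset e q < W.offset e b ∧
    ∀ r, W.Incident e r → ¬(W.offset e q < W.offset e r ∧ W.offset e r < W.offset e b)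

instance (e : Fin n) (b q : Fin k) : Decidable (W.Next e b q) := by
  unfold Next; infer_instance

/-- The `2 × 2` minor of `C(W)` in the rows `b`, `q` and the columns `e`, `e + 1`. -/
def edgeMinor (e : Fin n) (b q : Fin k) : CRing k n :=
  c b e * c q (e + 1) - c q e * c b (e + 1)

/-! ### Boundary diagrams -/

/-- The edge on which the endpoint of the propagator `b` at the vertex `v` of its support lies. -/
def edgeAt (b : Fin k) (v : Fin n) : Fin n :=
  if v = (W.prop b).1 ∨ v = (W.prop b).1 + 1 then (W.prop b).1 else (W.prop b).2

/-- Moving the endpoint of `b` away from the vertex `v`, it meets the endpoint of `q` before it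
reaches the other vertex of the edge. -/
def Touches (b : Fin k) (v : Fin n) (q : Fin k) : Prop :=
  (v = W.edgeAt b v ∧ W.Next (W.edgeAt b v) b q) ∨
    (v = W.edgeAt b v + 1 ∧ W.Next (W.edgeAt b v) q b)

open Classical in
/-- `Δ_{b,v}(W)`: the minor of `C(W)` that vanishes on the boundary diagram obtained by moving the
endpoint of the propagator `b` away from the vertex `v`. (At most one `q` is touched.) -/
def boundaryMinor (b : Fin k) (v : Fin n) : CRing k n :=
  if h : ∃ q, W.Touches b v q then edgeMinor (W.edgeAt b v) b h.choose else c b v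

/-- The matrix of the boundary diagram: `C(W)` with its entries subject to `Δ_{b,v}(W) = 0`. -/
def boundaryMat (b : Fin k) (v : Fin n) :
    Matrix (Fin k) (Fin n) (CRing k n ⧸ Ideal.span {W.boundaryMinor b v}) :=
  W.matC.map (Ideal.Quotient.mk (Ideal.span {W.boundaryMinor b v}))

/-- The cell parametrized by the boundary diagram `∂_{b,v}(W)`: its bases are the minors of the
boundary matrix that do not vanish identically. -/
def boundaryCell (b : Fin k) (v : Fin n) : Set (Grassmannian k n) :=
  cell {I | minor (W.boundaryMat b v) I ≠ 0}

/-! ### The localized integral -/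

/-- The indeterminate entries of the external data: the entries `Z_a^j`, `j ≤ 4 + k`, of the
particles, and the first four entries of the gauge vector `Z_*`, whose last `k` entries are `0`. -/
abbrev ExtVar (k n : ℕ) : Type := (Fin n × Fin (4 + k)) ⊕ Fin 4

/-- Polynomials in the external data. -/
abbrev ZRing (k n : ℕ) : Type := MvPolynomial (ExtVar k n) ℝ

/-- Rational functions of the external data. -/
abbrev ZField (k n : ℕ) : Type := FractionRing (ZRing k n)

/-- The first four entries of `Z_a`. -/
def twistor (k : ℕ) {n : ℕ} (a : Fin n) : Fin 4 → ZRing k n :=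
  fun μ => MvPolynomial.X (Sum.inl (a, Fin.castAdd k μ))

/-- The first four entries of `Z_*`. -/
def gauge (k n : ℕ) : Fin 4 → ZRing k n := fun μ => MvPolynomial.X (Sum.inr μ)

/-- The vertices `i, i + 1, j, j + 1` of the propagator `b = (i, j)`, in this order. -/
def corners (b : Fin k) : Fin 4 → Fin n :=
  ![(W.prop b).1, (W.prop b).1 + 1, (W.prop b).2, (W.prop b).2 + 1]

/-- The determinant `⟨i (i+1) j (j+1)⟩` for the propagator `b = (i, j)`. -/
def bracket (b : Fin k) : ZRing k n :=
  (Matrix.of fun r : Fin 4 => twistor k (W.corners b r)).det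

/-- `σ_{b,a}`: the determinant `⟨i (i+1) j (j+1)⟩` with `Z_a` replaced by `Z_*`. -/
def sigma (b : Fin k) (a : Fin n) : ZRing k n :=
  (Matrix.of fun r : Fin 4 =>
    if W.corners b r = a then gauge k n else twistor k (W.corners b r)).det

/-- The value of `c_{b,a}` at the solution of `C_*(W) Z_*^μ = 0`, that is, of
`Z_*^μ + ∑ a ∈ V_b, c_{b,a} Z_a^μ = 0`, given by Cramer's rule. -/
def cLoc (b : Fin k) (a : Fin n) : ZField k n :=
  if a ∈ W.support b then
    -(algebraMap (ZRing k n) (ZField k n) (W.sigma b a) /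
      algebraMap (ZRing k n) (ZField k n) (W.bracket b))
  else 0

/-- Localization: substitute the solution of `C_*(W) Z_*^μ = 0` into a polynomial in the
`c_{b,a}`. -/
def localize : CRing k n →ₐ[ℝ] ZField k n :=
  MvPolynomial.aeval fun x : Fin k × Fin n => W.cLoc x.1 x.2

/-- The factor of the denominator at the edge `e`. If `q_1, …, q_s` are the propagators on `e`,
ordered from the vertex `e` to the vertex `e + 1`, it is
`c_{q_1,e+1} c_{q_s,e} ∏ m < s, (c_{q_m,e} c_{q_{m+1},e+1} - c_{q_{m+1},e} c_{q_m,e+1})`. -/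
def denomEdge (e : Fin n) : CRing k n :=
  (∏ b with W.Incident e b ∧ ∀ r, ¬W.Next e r b, c b (e + 1)) *
    (∏ b with W.Incident e b ∧ ∀ r, ¬W.Next e b r, c b e) *
    ∏ x : Fin k × Fin k with W.Next e x.1 x.2, edgeMinor e x.1 x.2

/-- The denominator `R(W)`, a product over the edges that support a propagator. -/
def denom : CRing k n := ∏ e with ∃ b, W.Incident e b, W.denomEdge e

/-- The localized numerator factor of the propagator `b`: the fourth power of the `(4 + b)`-th entry
of the `b`-th row of `C_*(W) Z_*`. -/
def numer (b : Fin k) : ZField k n :=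
  (∑ a ∈ W.support b, W.cLoc b a *
    algebraMap (ZRing k n) (ZField k n) (MvPolynomial.X (Sum.inl (a, Fin.natAdd 4 b)))) ^ 4

/-- The localized integral `I(W)(Z_*)`, a rational function of the external data. -/
def integral : ZField k n := (∏ b, W.numer b) / W.localize W.denom

end Diagram

/-! ## Poles of rational functions of the external data -/

open Diagram

/-- The rational function `g` vanishes along the irreducible hypersurface `f = 0`. -/
def VanishesAlong {k n : ℕ} (g : ZField k n) (f : ZRing k n) : Prop :=
  ∃ N D : ZRing k n, f ∣ N ∧ ¬f ∣ D ∧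
    g * algebraMap (ZRing k n) (ZField k n) D = algebraMap (ZRing k n) (ZField k n) N

/-- The rational function `g` has a pole of order exactly one along the irreducible hypersurface
`f = 0`: it has the form `N / (f D)` with `N` and `D` not divisible by `f`. -/
def HasSimplePoleAlong {k n : ℕ} (g : ZField k n) (f : ZRing k n) : Prop :=
  ∃ N D : ZRing k n, ¬f ∣ N ∧ ¬f ∣ D ∧
    g * algebraMap (ZRing k n) (ZField k n) (f * D) = algebraMap (ZRing k n) (ZField k n) N

namespace Diagram

variable {k n : ℕ} [NeZero n] (W : Diagram k n)

/-- The minor `Δ_{b,v}(W)` is a simple pole of the localized integral: its localization vanishes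
along some irreducible hypersurface, and the integral has a pole of order one along every
irreducible hypersurface along which it vanishes. -/
def IsSimplePole (b : Fin k) (v : Fin n) : Prop :=
  (∃ f, Prime f ∧ VanishesAlong (W.localize (W.boundaryMinor b v)) f) ∧
    ∀ f, Prime f → VanishesAlong (W.localize (W.boundaryMinor b v)) f →
      HasSimplePoleAlong W.integral f

/-- A weaker reading of the same notion, for a localized minor that is not irreducible: the integral
has a pole of order one along at least one irreducible hypersurface along which the localization of
`Δ_{b,v}(W)` vanishes. -/
def IsSimplePoleOnComponent (b : Fin k) (v : Fin n) : Prop :=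
  ∃ f, Prime f ∧ VanishesAlong (W.localize (W.boundaryMinor b v)) f ∧
    HasSimplePoleAlong W.integral f

end Diagram

/-- `𝓦(k, n)`: the union of the closures `Σ(W)` over the admissible diagrams with `k` propagators on
`n` vertices. -/
def wilsonSpace (k n : ℕ) [NeZero n] : Set (Grassmannian k n) :=
  ⋃ (W : Diagram k n) (_ : W.Admissible), closure W.Sig

end

end WilsonLoop

namespace WilsonLoop

open MvPolynomial

/-! ## Irreducibility of generic determinants -/

/-! Both conditions on `B` are shown to be equivalent to a third, finite one: `B` is the cell of one
of the 44 shapes in `boundaryShapes`.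

A point of a rank two cell is a configuration of plane vectors. Let `S` be the set of nonzero
columns and `D` the set of first elements of the parallel classes, which are cyclic intervals of
`S`. Total nonnegativity makes this pair determine all bases (`exists_shape`), and scales of columns
together with gaps between classes are global coordinates, so the cell is a ball of dimension `|S| +
|D| - 4` (`hasDimension_shape`). Hence dimension five leaves two types: five columns in four
classes, or six columns in three classes.

There are 21 admissible diagrams. In nine of them two vertices are shared by the supports; each row
has a private pair of adjacent columns, and these pairs are the only nonbases. In the other twelve
three vertices are shared; one column is zero and all minors of the other five are nonzero, so each
missing column belongs to two diagrams with the same cell. A closure relation forces inclusion of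
bases (`pattern_le_of_subset_closure`). A shape on six columns can therefore lie only under diagrams
whose two private pairs are inside its classes: three diagrams for class sizes 2,2,2, two for 1,2,3,
but only one for 1,1,4. This removes the sizes 1,1,4 and nothing else; for the listed shapes
explicit shears give the closure relations (`exists_shears`).

On the analytic side, Cramer's rule turns a localized entry into a generic 4 × 4 determinant, and an
edge minor into the condition that three lines become concurrent after a projection. These
polynomials are irreducible, so the order of a pole is the multiplicity of a factor in the
denominator. An entry `c_{b,v}` gives a double factor when the three vertices of `V_b` other than
`v` also support the other propagator: both rows then contain the same determinant up to sign. In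
that case the boundary cell also has the wrong dimension, because the column `v` dies and four
columns in four classes remain. All other boundary cells are listed (`exists_boundaryShape`).
Conversely every listed shape is reached through an entry that is a simple factor, except for the
two partitions into three pairs, which are reached through an edge minor (`exists_simple`). -/

theorem not_dvd_of_eval {τ : Type*} {f g : MvPolynomial τ ℝ} (z : τ → ℝ) (hf : eval z f = 0)
    (hg : eval z g ≠ 0) : ¬f ∣ g := by
  rintro ⟨h, rfl⟩
  simp [hf] at hg

/-- A polynomial of degree one in a variable can only factor through a common divisor of its two
coefficients. As `f` is irreducible, it suffices that `f` does not divide `g`, and the point `z`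
certifies this. -/
theorem irreducible_linear {τ : Type*} {f g : MvPolynomial τ ℝ} (i : τ) (hf : Irreducible f)
    (hif : f ∈ supported ℝ {j | j ≠ i}) (hig : g ∈ supported ℝ {j | j ≠ i}) (z : τ → ℝ)
    (hfz : eval z f = 0) (hgz : eval z g ≠ 0) : Irreducible (f * X i + g) := by
  refine irreducible_mul_X_add f g i hf.ne_zero (fun h => ?_) (fun h => ?_)
    (hf.isRelPrime_iff_not_dvd.2 (not_dvd_of_eval z hfz hgz))
  · exact mem_supported.1 hif h rfl
  · exact mem_supported.1 hig h rfl

/-- An injective renaming is an isomorphism onto the polynomials in a subset of the variables, and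
adjoining further variables preserves primes. -/
theorem prime_rename {τ υ : Type*} {ι : τ → υ} (hι : Function.Injective ι)
    {p : MvPolynomial τ ℝ} (hp : Prime p) : Prime (rename ι p) := by
  have h1 : Prime (rename (Equiv.ofInjective ι hι) p) :=
    (MulEquiv.prime_iff (renameEquiv ℝ (Equiv.ofInjective ι hι))).2 hp
  have h2 := (prime_rename_iff (Set.range ι)).2 h1
  rwa [rename_rename] at h2

/-! ### Determinants as cofactor expansions, linear in one chosen entry -/

section Generic

variable {R : Type*} [CommRing R] {r : Type*}

/-- The `2 × 2` minor of the rows `i, j` in the columns `s, t`. -/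
def det2 (x : r → Fin 4 → R) (i j : r) (s t : Fin 4) : R := x i s * x j t - x i t * x j s

/-- The `3 × 3` minor of the rows `i, j, k` in the columns `s, t, u`. -/
def det3 (x : r → Fin 4 → R) (i j k : r) (s t u : Fin 4) : R :=
  det2 x j k t u * x i s + (det2 x j k s t * x i u - det2 x j k s u * x i t)

/-- The determinant of the rows `i, j, k, l`. -/
def det4 (x : r → Fin 4 → R) (i j k l : r) : R :=
  det3 x j k l 1 2 3 * x i 0 +
    (det3 x j k l 0 1 3 * x i 2 - det3 x j k l 0 2 3 * x i 1 - det3 x j k l 0 1 2 * x i 3)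

theorem det_eq_det4 (A : Fin 4 → Fin 4 → R) : (Matrix.of A).det = det4 A 0 1 2 3 := by
  rw [Matrix.det_succ_row_zero]
  simp [Fin.sum_univ_succ, Matrix.det_fin_three, Fin.succAbove, det4, det3, det2]
  ring

theorem map_det2 {S : Type*} [CommRing S] (θ : R →+* S) (x : r → Fin 4 → R) (i j : r)
    (s t : Fin 4) : θ (det2 x i j s t) = det2 (fun a μ => θ (x a μ)) i j s t := by simp [det2]

theorem map_det3 {S : Type*} [CommRing S] (θ : R →+* S) (x : r → Fin 4 → R) (i j k : r)
    (s t u : Fin 4) : θ (det3 x i j k s t u) = det3 (fun a μ => θ (x a μ)) i j k s t u := by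
  simp [det3, map_det2]

theorem map_det4 {S : Type*} [CommRing S] (θ : R →+* S) (x : r → Fin 4 → R) (i j k l : r) :
    θ (det4 x i j k l) = det4 (fun a μ => θ (x a μ)) i j k l := by
  simp [det4, map_det3]

/-- For seven points of projective three-space: the condition that the lines `01`, `23`, `45`
become concurrent after projection from the point `6`. -/
def concurrency (x : Fin 7 → Fin 4 → R) : R :=
  det4 x 1 6 2 3 * det4 x 0 6 4 5 - det4 x 1 6 4 5 * det4 x 0 6 2 3

theorem concurrency_comp {s : Type*} (x : s → Fin 4 → R) (ρ : Fin 7 → s) :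
    concurrency (fun i => x (ρ i)) = det4 x (ρ 1) (ρ 6) (ρ 2) (ρ 3) * det4 x (ρ 0) (ρ 6) (ρ 4) (ρ 5) -
      det4 x (ρ 1) (ρ 6) (ρ 4) (ρ 5) * det4 x (ρ 0) (ρ 6) (ρ 2) (ρ 3) := rfl

theorem map_concurrency {S : Type*} [CommRing S] (θ : R →+* S) (x : Fin 7 → Fin 4 → R) :
    θ (concurrency x) = concurrency (fun a μ => θ (x a μ)) := by
  simp [concurrency, map_det4]

end Generic

/-- The matrix of indeterminates. -/
noncomputable def genMat (r : Type*) (a : r) (μ : Fin 4) : MvPolynomial (r × Fin 4) ℝ := X (a, μ)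

theorem genMat_mem {r : Type*} {i : r × Fin 4} {a : r} {μ : Fin 4} (h : (a, μ) ≠ i) :
    genMat r a μ ∈ supported ℝ {j | j ≠ i} := X_mem_supported.2 h

theorem det2_mem {r : Type*} {i : r × Fin 4} {a b : r} {s t : Fin 4}
    (h : ∀ x ∈ [a, b], ∀ μ ∈ [s, t], (x, μ) ≠ i) :
    det2 (genMat r) a b s t ∈ supported ℝ {j | j ≠ i} := by
  have := fun x hx μ hμ => genMat_mem (h x hx μ hμ)
  simp only [List.mem_cons, List.not_mem_nil, or_false, forall_eq_or_imp, forall_eq] at this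
  obtain ⟨⟨h1, h2⟩, h3, h4⟩ := this
  exact sub_mem (mul_mem h1 h4) (mul_mem h2 h3)

theorem det3_mem {r : Type*} {i : r × Fin 4} {a b c : r} {s t u : Fin 4}
    (h : ∀ x ∈ [a, b, c], ∀ μ ∈ [s, t, u], (x, μ) ≠ i) :
    det3 (genMat r) a b c s t u ∈ supported ℝ {j | j ≠ i} := by
  refine add_mem (mul_mem (det2_mem ?_) (genMat_mem ?_))
    (sub_mem (mul_mem (det2_mem ?_) (genMat_mem ?_)) (mul_mem (det2_mem ?_) (genMat_mem ?_)))
  all_goals simp_all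

theorem det2_irreducible {r : Type*} [DecidableEq r] {a b : r} (hab : a ≠ b) {s t : Fin 4}
    (hst : s ≠ t) : Irreducible (det2 (genMat r) a b s t) := by
  have hX : Irreducible (genMat r b t) := X_prime.irreducible
  have h := irreducible_linear (f := genMat r b t) (g := -(genMat r a t * genMat r b s)) (a, s) hX
    (genMat_mem (by simp [hab.symm]))
    (neg_mem (mul_mem (genMat_mem (by simp [hst.symm])) (genMat_mem (by simp [hab.symm]))))
    (fun x => if x = (a, t) ∨ x = (b, s) then 1 else 0)
    (by simp [genMat, hab.symm, hst.symm]) (by simp [genMat])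
  convert h using 1
  simp only [det2, genMat]; ring

theorem det3_irreducible {r : Type*} [DecidableEq r] {a b c : r} (hab : a ≠ b) (hac : a ≠ c)
    (hbc : b ≠ c) {s t u : Fin 4} (hst : s ≠ t) (hsu : s ≠ u) (htu : t ≠ u) :
    Irreducible (det3 (genMat r) a b c s t u) := by
  have h := irreducible_linear (f := det2 (genMat r) b c t u)
    (g := det2 (genMat r) b c s t * genMat r a u - det2 (genMat r) b c s u * genMat r a t)
    (a, s) (det2_irreducible hbc htu)
    (det2_mem (by simp [hab.symm, hac.symm]))
    (sub_mem (mul_mem (det2_mem (by simp [hab.symm, hac.symm])) (genMat_mem (by simp [hsu.symm])))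
      (mul_mem (det2_mem (by simp [hab.symm, hac.symm])) (genMat_mem (by simp [hst.symm]))))
    (fun x => if x = (a, u) ∨ x = (b, s) ∨ x = (c, t) then 1 else 0)
    (by simp [genMat, det2, hab.symm, hst.symm, hac.symm, hsu.symm, hbc, hbc.symm, htu, htu.symm])
    (by simp [genMat, det2, hab.symm, hst, hst.symm, hac.symm, hsu, hsu.symm, hbc, hbc.symm, htu, htu.symm])
  exact h

theorem det4_irreducible {r : Type*} [DecidableEq r] {a b c d : r} (hab : a ≠ b) (hac : a ≠ c)
    (had : a ≠ d) (hbc : b ≠ c) (hbd : b ≠ d) (hcd : c ≠ d) :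
    Irreducible (det4 (genMat r) a b c d) := by
  have h := irreducible_linear (f := det3 (genMat r) b c d 1 2 3)
    (g := det3 (genMat r) b c d 0 1 3 * genMat r a 2 - det3 (genMat r) b c d 0 2 3 * genMat r a 1 -
      det3 (genMat r) b c d 0 1 2 * genMat r a 3)
    (a, 0) (det3_irreducible hbc hbd hcd (by decide) (by decide) (by decide))
    (det3_mem (by simp [hab.symm, hac.symm, had.symm]))
    (sub_mem (sub_mem
      (mul_mem (det3_mem (by simp [hab.symm, hac.symm, had.symm])) (genMat_mem (by simp)))
      (mul_mem (det3_mem (by simp [hab.symm, hac.symm, had.symm])) (genMat_mem (by simp))))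
      (mul_mem (det3_mem (by simp [hab.symm, hac.symm, had.symm])) (genMat_mem (by simp))))
    (fun x => if x = (a, 3) ∨ x = (b, 0) ∨ x = (c, 1) ∨ x = (d, 2) then 1 else 0)
    (by simp [genMat, det2, det3, hab.symm, hac.symm, had.symm, hbc, hbc.symm, hbd, hbd.symm, hcd, hcd.symm])
    (by simp [genMat, det2, det3, hab.symm, hac.symm, had.symm, hbc, hbc.symm, hbd, hbd.symm, hcd, hcd.symm])
  exact h

/-- The polynomial is bilinear in the rows 0 and 1, with coefficients the 2 × 2 minors of two
covectors `P`, `Q`. Once a single such minor is known to be irreducible, linearity in an entry of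
row 1 and then in an entry of row 0 gives the rest. -/
theorem concurrency_irreducible : Irreducible (concurrency (genMat (Fin 7))) := by
  set x := genMat (Fin 7) with hx
  -- `P` and `Q` are the planes spanned by the points 6, 2, 3 and 6, 4, 5: the pairing of `P` with
  -- row `a` is `det4 x a 6 2 3`.
  let P : Fin 4 → MvPolynomial (Fin 7 × Fin 4) ℝ :=
    ![det3 x 6 2 3 1 2 3, -det3 x 6 2 3 0 2 3, det3 x 6 2 3 0 1 3, -det3 x 6 2 3 0 1 2]
  let Q : Fin 4 → MvPolynomial (Fin 7 × Fin 4) ℝ :=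
    ![det3 x 6 4 5 1 2 3, -det3 x 6 4 5 0 2 3, det3 x 6 4 5 0 1 3, -det3 x 6 4 5 0 1 2]
  let w (l : List (Fin 7 × Fin 4)) (p : Fin 7 × Fin 4) : ℝ := if p ∈ l then 1 else 0
  have hP : ∀ i : Fin 7 × Fin 4, i.1 ≠ 6 ∧ i.1 ≠ 2 ∧ i.1 ≠ 3 → ∀ r,
      P r ∈ supported ℝ {j | j ≠ i} := by
    rintro ⟨i, μ⟩ ⟨h6, h2, h3⟩ r
    fin_cases r
    · exact det3_mem (by simp_all [eq_comm])
    · exact neg_mem (det3_mem (by simp_all [eq_comm]))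
    · exact det3_mem (by simp_all [eq_comm])
    · exact neg_mem (det3_mem (by simp_all [eq_comm]))
  have hQ : ∀ i : Fin 7 × Fin 4, i.1 ≠ 6 ∧ i.1 ≠ 4 ∧ i.1 ≠ 5 → ∀ r,
      Q r ∈ supported ℝ {j | j ≠ i} := by
    rintro ⟨i, μ⟩ ⟨h6, h2, h3⟩ r
    fin_cases r
    · exact det3_mem (by simp_all [eq_comm])
    · exact neg_mem (det3_mem (by simp_all [eq_comm]))
    · exact det3_mem (by simp_all [eq_comm])
    · exact neg_mem (det3_mem (by simp_all [eq_comm]))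
  have hPQ : ∀ i : Fin 7 × Fin 4, i.1 = 0 ∨ i.1 = 1 → ∀ r s,
      P r * Q s - Q r * P s ∈ supported ℝ {j | j ≠ i} := by
    intro i hi r s
    have h1 := hP i (by rcases hi with h | h <;> simp [h])
    have h2 := hQ i (by rcases hi with h | h <;> simp [h])
    exact sub_mem (mul_mem (h1 r) (h2 s)) (mul_mem (h2 r) (h1 s))
  -- Of the four covector entries involved, only `P 1` contains `x 2 0`, with coefficient `det2 x 6
  -- 3 2 3`. The leading coefficient in this variable is thus a product of two irreducibles, and
  -- each of them needs its own 0/1 point to show that it does not divide the remainder.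
  have e1 : Irreducible (P 1 * Q 0 - Q 1 * P 0) := by
    have hκ : Irreducible (det2 x 6 3 2 3) := det2_irreducible (by decide) (by decide)
    have hQ0 : Irreducible (Q 0) := det3_irreducible (by decide) (by decide) (by decide) (by decide)
      (by decide) (by decide)
    let g := (det2 x 6 3 0 2 * x 2 3 - det2 x 6 3 0 3 * x 2 2) * Q 0 - Q 1 * P 0
    have h := irreducible_mul_X_add (det2 x 6 3 2 3 * Q 0) g (2, 0)
      (mul_ne_zero hκ.ne_zero hQ0.ne_zero)
      (fun h => mem_supported.1 (mul_mem (det2_mem (by simp)) (hQ (2, 0) (by simp) 0)) h rfl)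
      (fun h => mem_supported.1 (sub_mem (mul_mem (sub_mem
        (mul_mem (det2_mem (by simp)) (genMat_mem (by simp)))
        (mul_mem (det2_mem (by simp)) (genMat_mem (by simp)))) (hQ (2, 0) (by simp) 0))
        (mul_mem (hQ (2, 0) (by simp) 1) (det3_mem (by simp)))) h rfl)
      (IsRelPrime.mul_left
        (hκ.isRelPrime_iff_not_dvd.2 (not_dvd_of_eval (w [(6, 3), (2, 2), (3, 0), (4, 1), (5, 2)])
          (by simp [hx, det2, genMat, w]) (by simp [hx, g, P, Q, det3, det2, genMat, w])))
        (hQ0.isRelPrime_iff_not_dvd.2 (not_dvd_of_eval (w [(6, 3), (2, 1), (3, 2), (4, 0), (5, 2)])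
          (by simp [hx, Q, det3, det2, genMat, w])
          (by simp [hx, g, P, Q, det3, det2, genMat, w]))))
    convert h using 1
    change _ = _ * x 2 0 + _
    simp only [g, P, Q, det3, det2, Matrix.cons_val]
    ring
  have e2 : Irreducible ((P 1 * Q 0 - Q 1 * P 0) * x 1 1 +
      ((P 2 * Q 0 - Q 2 * P 0) * x 1 2 + (P 3 * Q 0 - Q 3 * P 0) * x 1 3)) :=
    irreducible_linear (1, 1) e1 (hPQ _ (by simp) _ _)
      (add_mem (mul_mem (hPQ _ (by simp) _ _) (genMat_mem (by simp)))
        (mul_mem (hPQ _ (by simp) _ _) (genMat_mem (by simp))))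
      (w [(6, 3), (2, 0), (3, 1), (4, 1), (5, 2), (1, 2)])
      (by simp [hx, P, Q, det3, det2, genMat, w]) (by simp [hx, P, Q, det3, det2, genMat, w])
  have e3 : Irreducible (((P 1 * Q 0 - Q 1 * P 0) * x 1 1 +
      ((P 2 * Q 0 - Q 2 * P 0) * x 1 2 + (P 3 * Q 0 - Q 3 * P 0) * x 1 3)) * x 0 0 +
      ∑ s : Fin 3, (∑ r : Fin 4, (P r * Q s.succ - Q r * P s.succ) * x 1 r) * x 0 s.succ) :=
    irreducible_linear (0, 0) e2
      (add_mem (mul_mem (hPQ _ (by simp) _ _) (genMat_mem (by simp)))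
        (add_mem (mul_mem (hPQ _ (by simp) _ _) (genMat_mem (by simp)))
          (mul_mem (hPQ _ (by simp) _ _) (genMat_mem (by simp)))))
      (sum_mem fun s _ => mul_mem (sum_mem fun r _ =>
        mul_mem (hPQ _ (by simp) _ _) (genMat_mem (by simp))) (genMat_mem (by simp)))
      (w [(6, 3), (2, 0), (3, 1), (4, 1), (5, 2), (1, 0), (0, 2)])
      (by simp [hx, P, Q, det3, det2, genMat, w])
      (by simp [hx, P, Q, det3, det2, genMat, w, Fin.sum_univ_succ])
  convert e3 using 1
  have h4 : ∀ a b c d, det4 x a b c d = det3 x b c d 1 2 3 * x a 0 +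
    (det3 x b c d 0 1 3 * x a 2 - det3 x b c d 0 2 3 * x a 1 - det3 x b c d 0 1 2 * x a 3) :=
    fun _ _ _ _ => rfl
  simp only [concurrency, h4, P, Q, Fin.sum_univ_four, Fin.sum_univ_three, Matrix.cons_val]
  generalize det3 x 6 2 3 1 2 3 = a0, det3 x 6 2 3 0 2 3 = a1, det3 x 6 2 3 0 1 3 = a2,
    det3 x 6 2 3 0 1 2 = a3, det3 x 6 4 5 1 2 3 = b0, det3 x 6 4 5 0 2 3 = b1,
    det3 x 6 4 5 0 1 3 = b2, det3 x 6 4 5 0 1 2 = b3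
  simp only [Fin.succ_zero_eq_one, Fin.succ_one_eq_two, Matrix.cons_val, Fin.reduceSucc]
  ring

namespace Diagram

/-! ## Clearing denominators in the localized integral -/

/-- The embedding of the external data into the rational functions. -/
noncomputable abbrev toField (k n : ℕ) : ZRing k n →+* ZField k n :=
  algebraMap (ZRing k n) (ZField k n)

theorem toField_injective {k n : ℕ} : Function.Injective (toField k n) :=
  IsFractionRing.injective (ZRing k n) (ZField k n)

section Clear

variable {k n : ℕ} [NeZero n] (W : Diagram k n)

/-- Localization without the denominators `⟨i (i+1) j (j+1)⟩`. -/
noncomputable def clear : CRing k n →ₐ[ℝ] ZRing k n :=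
  aeval fun x : Fin k × Fin n => if x.2 ∈ W.support x.1 then -W.sigma x.1 x.2 else 0

/-- The numerator factor of the propagator `b` without its denominator. -/
noncomputable def clearNumer (b : Fin k) : ZRing k n :=
  ∑ a ∈ W.support b, -W.sigma b a * X (Sum.inl (a, Fin.natAdd 4 b))

/-- Products of the determinants `⟨i (i+1) j (j+1)⟩`. -/
noncomputable def brackets : Submonoid (ZRing k n) := Submonoid.closure (Set.range W.bracket)

theorem bracket_mem (b : Fin k) : W.bracket b ∈ W.brackets :=
  Submonoid.subset_closure ⟨b, rfl⟩

theorem not_dvd_of_mem_brackets {f : ZRing k n} (hf : Prime f) (h : ∀ b, ¬f ∣ W.bracket b)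
    {m : ZRing k n} (hm : m ∈ W.brackets) : ¬f ∣ m := by
  induction hm using Submonoid.closure_induction with
  | mem x hx => obtain ⟨b, rfl⟩ := hx; exact h b
  | one => exact fun h1 => hf.not_isUnit (isUnit_of_dvd_one h1)
  | mul x y _ _ hx hy => exact fun hxy => (hf.dvd_or_dvd hxy).elim hx hy

/-- A polynomial in the `c_{b,a}` whose localization has a product of brackets as denominator. -/
def Clears (P : CRing k n) : Prop :=
  ∃ m ∈ W.brackets, W.localize P * toField k n m = toField k n (W.clear P)

theorem clears_mul {P Q : CRing k n} (hP : W.Clears P) (hQ : W.Clears Q) : W.Clears (P * Q) := by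
  obtain ⟨m, hm, h⟩ := hP
  obtain ⟨m', hm', h'⟩ := hQ
  exact ⟨m * m', mul_mem hm hm', by simp only [map_mul, ← h, ← h']; ring⟩

theorem clears_list_prod (l : List (CRing k n)) (h : ∀ P ∈ l, W.Clears P) : W.Clears l.prod := by
  induction l with
  | nil => exact ⟨1, one_mem _, by simp⟩
  | cons a l ih =>
    rw [List.prod_cons]
    exact W.clears_mul (h a (by simp)) (ih fun P hP => h P (by simp [hP]))

theorem cLoc_mul_bracket {b : Fin k} (hb : W.bracket b ≠ 0) (a : Fin n) :
    W.localize (c b a) * toField k n (W.bracket b) = toField k n (W.clear (c b a)) := by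
  have : toField k n (W.bracket b) ≠ 0 := fun h => hb (toField_injective (by simpa using h))
  simp only [localize, c, aeval_X, cLoc, clear]
  split_ifs
  · simp only [map_neg, neg_mul, neg_inj]
    exact div_mul_cancel₀ _ this
  · simp

theorem clears_c {b : Fin k} (hb : W.bracket b ≠ 0) (a : Fin n) : W.Clears (c b a) :=
  ⟨_, W.bracket_mem b, W.cLoc_mul_bracket hb a⟩

/-- Sums need not clear, since their terms may carry different denominators. Here both products have
degree one in each of the rows `b` and `q`, so the product of the two brackets serves for both. -/
theorem clears_edgeMinor (hb : ∀ b, W.bracket b ≠ 0) (e : Fin n) (b q : Fin k) :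
    W.Clears (edgeMinor e b q) := by
  refine ⟨_, mul_mem (W.bracket_mem b) (W.bracket_mem q), ?_⟩
  have h1 := W.cLoc_mul_bracket (hb b) e
  have h2 := W.cLoc_mul_bracket (hb b) (e + 1)
  have h3 := W.cLoc_mul_bracket (hb q) e
  have h4 := W.cLoc_mul_bracket (hb q) (e + 1)
  simp only [edgeMinor, map_mul, map_sub, ← h1, ← h2, ← h3, ← h4]
  ring

theorem numer_mul_bracket {b : Fin k} (hb : W.bracket b ≠ 0) :
    W.numer b * toField k n (W.bracket b ^ 4) = toField k n (W.clearNumer b ^ 4) := by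
  rw [numer, map_pow, map_pow, ← mul_pow, clearNumer, map_sum, Finset.sum_mul]
  congr 1
  refine Finset.sum_congr rfl fun a ha => ?_
  have h := W.cLoc_mul_bracket hb a
  simp only [localize, c, aeval_X, clear, ha, if_true] at h
  rw [map_mul, ← h]
  ring

theorem integral_clear (hb : ∀ b, W.bracket b ≠ 0) (hR : W.Clears W.denom)
    (h0 : W.localize W.denom ≠ 0) : ∃ m ∈ W.brackets, ∃ m' ∈ W.brackets,
      W.integral * toField k n (W.clear W.denom * m) =
        toField k n ((∏ b, W.clearNumer b ^ 4) * m') := by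
  obtain ⟨m', hm', h⟩ := hR
  refine ⟨∏ b, W.bracket b ^ 4, prod_mem fun b _ => pow_mem (W.bracket_mem b) 4, m', hm', ?_⟩
  rw [map_mul, ← h, integral, map_mul, map_prod, map_prod,
    ← Finset.prod_congr rfl fun b _ => W.numer_mul_bracket (hb b), Finset.prod_mul_distrib]
  field_simp

theorem dvd_clear_of_vanishesAlong {P : CRing k n} (hP : W.Clears P) {f : ZRing k n} (hf : Prime f)
    (h : VanishesAlong (W.localize P) f) : f ∣ W.clear P := by
  obtain ⟨N, D, hN, hD, h⟩ := h
  obtain ⟨m, -, hm⟩ := hP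
  have : W.clear P * D = N * m := by
    apply toField_injective
    rw [map_mul, map_mul, ← hm, ← h]
    ring
  exact (hf.dvd_or_dvd (this ▸ hN.mul_right m)).resolve_right hD

theorem vanishesAlong_clear {P : CRing k n} (hP : W.Clears P) (hf : Prime (W.clear P))
    (h : ∀ b, ¬W.clear P ∣ W.bracket b) : VanishesAlong (W.localize P) (W.clear P) := by
  obtain ⟨m, hm, hm'⟩ := hP
  exact ⟨_, m, dvd_rfl, W.not_dvd_of_mem_brackets hf h hm, hm'⟩

/-- A sufficient condition for a simple pole: the localized minor is irreducible and it divides the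
denominator exactly once. -/
theorem isSimplePole_of_prime {b : Fin k} {v : Fin n} {P Q : CRing k n}
    (hΔ : W.boundaryMinor b v = P) (hP : W.Clears P)
    (hR : W.Clears W.denom) (hd : W.denom = P * Q) (hf : Prime (W.clear P))
    (hb : ∀ b, ¬W.clear P ∣ W.bracket b) (hN : ∀ b, ¬W.clear P ∣ W.clearNumer b)
    (hQ : ¬W.clear P ∣ W.clear Q) : W.IsSimplePole b v := by
  have hb0 : ∀ b, W.bracket b ≠ 0 := fun b h => hb b (h ▸ dvd_zero _)
  have h0 : W.localize W.denom ≠ 0 := by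
    intro h
    obtain ⟨m, -, hm⟩ := hR
    have h1 : W.clear W.denom = 0 := toField_injective (by rw [← hm, h, zero_mul, map_zero])
    rw [hd, map_mul, mul_eq_zero] at h1
    exact h1.elim hf.ne_zero fun h => hQ (h ▸ dvd_zero _)
  obtain ⟨m, hm, m', hm', h⟩ := W.integral_clear hb0 hR h0
  have key : HasSimplePoleAlong W.integral (W.clear P) := by
    refine ⟨(∏ b, W.clearNumer b ^ 4) * m', W.clear Q * m, fun h1 => ?_, fun h1 => ?_, ?_⟩
    rotate_left 2
    · rw [← mul_assoc, ← map_mul W.clear, ← hd]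
      exact h
    · rcases hf.dvd_or_dvd h1 with h2 | h2
      · obtain ⟨b, -, h3⟩ := (hf.dvd_finsetProd_iff _).1 h2
        exact hN b (hf.dvd_of_dvd_pow h3)
      · exact W.not_dvd_of_mem_brackets hf hb hm' h2
    · rcases hf.dvd_or_dvd h1 with h2 | h2
      · exact hQ h2
      · exact W.not_dvd_of_mem_brackets hf hb hm h2
  refine ⟨⟨_, hf, by rw [hΔ]; exact W.vanishesAlong_clear hP hf hb⟩, fun f hf' hv => ?_⟩
  rw [hΔ] at hv
  -- Up to a unit, the cleared minor is the only prime along which the localized minor vanishes, so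
  -- the pole along it settles all of them.
  have hass := hf'.associated_of_dvd hf (W.dvd_clear_of_vanishesAlong hP hf' hv)
  obtain ⟨N, D, h1, h2, h3⟩ := key
  obtain ⟨u, hu⟩ := hass
  refine ⟨N, u * D, fun h => h1 ?_, fun h => h2 ?_, ?_⟩
  · rw [← hu]
    exact (Units.mul_right_dvd).2 h
  · rw [← hu]
    exact (Units.mul_right_dvd).2 ((Units.dvd_mul_left).1 h)
  · rw [← mul_assoc, hu]
    exact h3

/-- A sufficient condition for the absence of a simple pole: the localized minor is irreducible and
its square divides the denominator. -/
theorem not_isSimplePoleOnComponent_of_sq_dvd {b : Fin k} {v : Fin n} {P : CRing k n}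
    (hΔ : W.boundaryMinor b v = P) (hP : W.Clears P) (hR : W.Clears W.denom)
    (hd : W.clear P ^ 2 ∣ W.clear W.denom) (hf : Prime (W.clear P))
    (hb : ∀ b, ¬W.clear P ∣ W.bracket b) (hN : ∀ b, ¬W.clear P ∣ W.clearNumer b) :
    ¬W.IsSimplePoleOnComponent b v := by
  rintro ⟨f, hf', hv, N, D, h1, h2, h3⟩
  rw [hΔ] at hv
  have hb0 : ∀ b, W.bracket b ≠ 0 := fun b h => hb b (h ▸ dvd_zero _)
  have hass := hf'.associated_of_dvd hf (W.dvd_clear_of_vanishesAlong hP hf' hv)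
  by_cases h0 : W.localize W.denom = 0
  -- Division by zero makes the integral zero here; then `N = 0`, which `f` divides.
  · refine h1 ?_
    rw [integral, h0, div_zero, zero_mul] at h3
    rw [toField_injective (h3.symm.trans (map_zero _).symm)]
    exact dvd_zero _
  obtain ⟨m, hm, m', hm', h⟩ := W.integral_clear hb0 hR h0
  have h4 : (∏ b, W.clearNumer b ^ 4) * m' * (f * D) = N * (W.clear W.denom * m) := by
    apply toField_injective
    rw [map_mul (toField k n) (_ * m'), ← h, map_mul (toField k n) N, ← h3]
    ring
  have h5 : f * f ∣ W.clear W.denom := by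
    rw [← pow_two]
    exact (pow_dvd_pow_of_dvd hass.dvd 2).trans hd
  obtain ⟨E, hE⟩ := h5
  -- One of the two factors `f` of the denominator cancels against the assumed simple pole. The
  -- other remains and would have to divide a numerator, a bracket or `D`.
  have h6 : (∏ b, W.clearNumer b ^ 4) * m' * D = f * (N * E * m) := by
    apply mul_left_cancel₀ hf'.ne_zero
    linear_combination h4 + N * m * hE
  have hb' : ∀ b, ¬f ∣ W.bracket b := fun b h => hb b (hass.dvd_iff_dvd_left.1 h)
  rcases hf'.dvd_or_dvd ⟨_, h6⟩ with h7 | h7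
  · rcases hf'.dvd_or_dvd h7 with h8 | h8
    · obtain ⟨b, -, h9⟩ := (hf'.dvd_finsetProd_iff _).1 h8
      exact hN b (hass.dvd_iff_dvd_left.1 (hf'.dvd_of_dvd_pow h9))
    · exact W.not_dvd_of_mem_brackets hf' hb' hm' h8
  · exact h2 h7

theorem IsSimplePole.onComponent {W : Diagram k n} {b : Fin k} {v : Fin n}
    (h : W.IsSimplePole b v) : W.IsSimplePoleOnComponent b v := by
  obtain ⟨⟨f, hf, hv⟩, h⟩ := h
  exact ⟨f, hf, hv, h f hf hv⟩

end Clear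

/-! ## The diagrams with two propagators on six vertices -/

/-- The diagram with the propagators `(i, j)` and `(k, l)`. -/
def diag (i j k l : Fin 6) (h : i < j ∧ k < l ∧ (i < k ∨ i = k ∧ l < j) := by decide) :
    Diagram 2 6 where
  prop := ![(i, j), (k, l)]
  fst_lt_snd b := by
    fin_cases b
    · exact h.1
    · exact h.2.1
  ordered b c hbc := by
    fin_cases b <;> fin_cases c
    · exact absurd hbc (lt_irrefl _)
    · exact h.2.2
    · exact absurd hbc (by decide)
    · exact absurd hbc (lt_irrefl _)

/-- The admissible diagrams. -/
def diagrams : List (Diagram 2 6) :=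
  [diag 0 2 2 4, diag 0 2 2 5, diag 0 2 3 5, diag 0 3 0 2, diag 0 3 1 3, diag 0 3 3 5,
    diag 0 4 0 2, diag 0 4 0 3, diag 0 4 1 3, diag 0 4 1 4, diag 0 4 2 4, diag 1 3 3 5,
    diag 1 4 1 3, diag 1 4 2 4, diag 1 5 1 3, diag 1 5 1 4, diag 1 5 2 4, diag 1 5 2 5,
    diag 1 5 3 5, diag 2 5 2 4, diag 2 5 3 5]

theorem diagrams_admissible : ∀ W ∈ diagrams, W.Admissible := by
  intro W hW
  refine ⟨by decide, ?_, ?_⟩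
  · revert W; decide +kernel
  · revert W; decide +kernel

/-- Density of the single propagators excludes adjacent edges, so the candidates are the nine
diagonals of a hexagon; 21 pairs of them do not cross. Density of the pair is then automatic. -/
theorem prop_mem_of_conditions : ∀ i j : Fin 6, i < j →
    4 ≤ ({i, i + 1, j, j + 1} : Finset (Fin 6)).card → ∀ k l : Fin 6, k < l →
    (i < k ∨ i = k ∧ l < j) → 4 ≤ ({k, k + 1, l, l + 1} : Finset (Fin 6)).card →
    ¬(i < k ∧ k < j ∧ j < l) → ∃ W ∈ diagrams, W.prop 0 = (i, j) ∧ W.prop 1 = (k, l) := by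
  decide +kernel

theorem mem_diagrams (W : Diagram 2 6) (hW : W.Admissible) : W ∈ diagrams := by
  obtain ⟨W', hW', h0, h1⟩ := prop_mem_of_conditions (W.prop 0).1 (W.prop 0).2 (W.fst_lt_snd 0)
    (by simpa [support] using hW.density {0} ⟨0, by simp⟩) (W.prop 1).1 (W.prop 1).2
    (W.fst_lt_snd 1) (W.ordered 0 1 (by decide))
    (by simpa [support] using hW.density {1} ⟨1, by simp⟩) (hW.noncrossing 0 1)
  have : W = W' := by
    ext1
    funext b
    fin_cases b
    · exact h0.symm
    · exact h1.symm
  exact this ▸ hW'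

/-! ### The factors of the denominator -/

variable (W : Diagram 2 6)

instance (b : Fin 2) (v : Fin 6) (q : Fin 2) : Decidable (W.Touches b v q) := by
  unfold Touches; infer_instance

/-- Names for the polynomials `c_{b,a}` and for the minors on an edge. -/
inductive Factor
  | entry (b : Fin 2) (a : Fin 6)
  | edge (e : Fin 6) (b q : Fin 2)
  deriving DecidableEq

/-- The value of a factor at a matrix. -/
def Factor.val {R : Type*} [CommRing R] (C : Fin 2 → Fin 6 → R) : Factor → R
  | .entry b a => C b a
  | .edge e b q => C b e * C q (e + 1) - C q e * C b (e + 1)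

theorem Factor.map_val {R S : Type*} [CommRing R] [CommRing S] (θ : R →+* S)
    (C : Fin 2 → Fin 6 → R) (d : Factor) : θ (d.val C) = d.val fun b a => θ (C b a) := by
  cases d <;> simp [Factor.val]

/-- The factors of `R_e(W)`. -/
def edgeFactors (e : Fin 6) : List Factor :=
  ([0, 1].filter fun b => W.Incident e b ∧ ∀ r, ¬W.Next e r b).map (fun b => .entry b (e + 1)) ++
  ([0, 1].filter fun b => W.Incident e b ∧ ∀ r, ¬W.Next e b r).map (fun b => .entry b e) ++
  ([(0, 0), (0, 1), (1, 0), (1, 1)].filter fun x : Fin 2 × Fin 2 => W.Next e x.1 x.2).map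
    (fun x => .edge e x.1 x.2)

/-- The factors of `R(W)`. -/
def factors : List Factor := [0, 1, 2, 3, 4, 5].flatMap W.edgeFactors

theorem prod_filter_eq_list {α M : Type*} [Fintype α] [DecidableEq α] [CommMonoid M] (l : List α)
    (hl : l.Nodup) (hu : l.toFinset = Finset.univ) (p : α → Prop) [DecidablePred p] (f : α → M) :
    ∏ x with p x, f x = ((l.filter fun x => p x).map f).prod := by
  rw [← List.prod_toFinset f (hl.filter _), List.toFinset_filter, hu]
  simp

theorem denomEdge_eq (e : Fin 6) :
    W.denomEdge e = ((W.edgeFactors e).map (Factor.val c)).prod := by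
  simp only [denomEdge, edgeFactors, List.map_append, List.prod_append, List.map_map]
  exact congrArg₂ (· * ·) (congrArg₂ (· * ·)
    (prod_filter_eq_list [0, 1] (by decide) (by decide) _ _)
    (prod_filter_eq_list [0, 1] (by decide) (by decide) _ _))
    (prod_filter_eq_list [(0, 0), (0, 1), (1, 0), (1, 1)] (by decide) (by decide) _ _)

theorem denom_eq : W.denom = (W.factors.map (Factor.val c)).prod := by
  have h1 : ∀ e, (¬∃ b, W.Incident e b) → W.denomEdge e = 1 := by
    intro e he
    push Not at he
    simp [denomEdge, he, Next]
  have h2 : W.denom = ∏ e, W.denomEdge e := by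
    rw [denom, Finset.prod_filter]
    refine Finset.prod_congr rfl fun e _ => ?_
    split_ifs with h
    · rfl
    · exact (h1 e h).symm
  rw [h2, factors]
  simp [Fin.prod_univ_six, denomEdge_eq, mul_assoc]

/-- The factor of the denominator that vanishes on the boundary diagram `∂_{b,v}(W)`. -/
def boundaryFactor (b : Fin 2) (v : Fin 6) : Factor :=
  if W.Touches b v (b + 1) then .edge (W.edgeAt b v) b (b + 1) else .entry b v

theorem Touches.eq_add_one {W : Diagram 2 6} {b q : Fin 2} {v : Fin 6} (h : W.Touches b v q) :
    q = b + 1 := by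
  have : q ≠ b := by
    rintro rfl
    rcases h with h | h <;> exact lt_irrefl _ h.2.2.2.1
  omega

/-- With two propagators the only one that can be touched is `b + 1`, which makes the choice in the
definition explicit and decidable. -/
theorem boundaryMinor_eq (b : Fin 2) (v : Fin 6) :
    W.boundaryMinor b v = (W.boundaryFactor b v).val c := by
  rw [boundaryMinor, boundaryFactor]
  split_ifs with h1 h2 h2
  · rw [h1.choose_spec.eq_add_one]; rfl
  · obtain ⟨q, hq⟩ := h1
    exact absurd (hq.eq_add_one ▸ hq) h2
  · exact absurd ⟨_, h2⟩ h1
  · rfl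

theorem clears_val (hb : ∀ b, W.bracket b ≠ 0) (d : Factor) : W.Clears (d.val c) := by
  rcases d with ⟨b, a⟩ | ⟨e, b, q⟩
  · exact W.clears_c (hb b) a
  · exact W.clears_edgeMinor hb e b q

theorem clears_denom (hb : ∀ b, W.bracket b ≠ 0) : W.Clears W.denom := by
  rw [denom_eq]
  refine W.clears_list_prod _ fun P hP => ?_
  obtain ⟨d, -, rfl⟩ := List.mem_map.1 hP
  exact W.clears_val hb d

/-! ### Numerical values of the localized factors -/

/-- The position of the variables of the six points and of the gauge vector. -/
def extVar (x : Fin 7 × Fin 4) : ExtVar 2 6 :=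
  Fin.lastCases (motive := fun _ => ExtVar 2 6) (Sum.inr x.2)
    (fun a => Sum.inl (a, Fin.castAdd 2 x.2)) x.1

theorem extVar_last (μ : Fin 4) : extVar (Fin.last 6, μ) = Sum.inr μ := rfl

theorem extVar_castSucc (a : Fin 6) (μ : Fin 4) :
    extVar (a.castSucc, μ) = Sum.inl (a, Fin.castAdd 2 μ) := by
  simp [extVar]

theorem extVar_injective : Function.Injective extVar := by
  rintro ⟨i, μ⟩ ⟨j, ν⟩ h
  induction i using Fin.lastCases <;> induction j using Fin.lastCases <;>
    simp only [extVar_last, extVar_castSucc, reduceCtorEq, Sum.inl.injEq, Sum.inr.injEq,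
      Prod.mk.injEq, Fin.castAdd_inj] at h
  · rw [h]
  · rw [h.1, h.2]

/-- The `4 × 4` minors of the external data. -/
noncomputable def extDet (i j k l : Fin 7) : ZRing 2 6 :=
  det4 (fun a μ => X (extVar (a, μ))) i j k l

theorem rename_det4 (i j k l : Fin 7) :
    rename extVar (det4 (genMat (Fin 7)) i j k l) = extDet i j k l := by
  refine (map_det4 (rename extVar : _ →ₐ[ℝ] ZRing 2 6).toRingHom _ _ _ _ _).trans ?_
  simp [genMat, extDet]

/-- The rows of the determinant `σ_{b,a}`. -/
def sigmaRow (b : Fin 2) (a : Fin 6) (r : Fin 4) : Fin 7 :=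
  if W.corners b r = a then 6 else (W.corners b r).castSucc

theorem sigma_eq (b : Fin 2) (a : Fin 6) :
    W.sigma b a = extDet (W.sigmaRow b a 0) (W.sigmaRow b a 1) (W.sigmaRow b a 2)
      (W.sigmaRow b a 3) := by
  have : (fun r => if W.corners b r = a then gauge 2 6 else twistor 2 (W.corners b r)) =
      fun r μ => X (extVar (W.sigmaRow b a r, μ)) := by
    funext r μ
    rw [sigmaRow]
    split_ifs
    · rfl
    · rw [extVar_castSucc]; rfl
  rw [sigma, this, det_eq_det4]
  rfl

theorem bracket_eq (b : Fin 2) :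
    W.bracket b = extDet (W.corners b 0).castSucc (W.corners b 1).castSucc
      (W.corners b 2).castSucc (W.corners b 3).castSucc := by
  have : (fun r => twistor 2 (W.corners b r)) =
      fun r μ => X (extVar ((W.corners b r).castSucc, μ)) := by
    funext r μ
    rw [extVar_castSucc]; rfl
  rw [bracket, this, det_eq_det4]
  rfl

/-- External data with integral entries; the last entries of each particle repeat the first. -/
def point (u : Fin 7 → Fin 4 → ℤ) : ExtVar 2 6 → ℝ
  | Sum.inl (a, j) => if h : (j : ℕ) < 4 then u a.castSucc ⟨j, h⟩ else u a.castSucc 0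
  | Sum.inr μ => u 6 μ

theorem eval_extDet (u : Fin 7 → Fin 4 → ℤ) (i j k l : Fin 7) :
    eval (point u) (extDet i j k l) = (det4 u i j k l : ℤ) := by
  have h : ∀ i μ, point u (extVar (i, μ)) = u i μ := by
    intro i μ
    induction i using Fin.lastCases with
    | last => rw [extVar_last]; rfl
    | cast a => simp [extVar_castSucc, point]
  rw [extDet, map_det4]
  simp only [eval_X, h]
  exact (map_det4 (Int.castRingHom ℝ) u i j k l).symm

/-- The value of the cleared localization of `c_{b,a}`. -/
def clearVal (u : Fin 7 → Fin 4 → ℤ) (b : Fin 2) (a : Fin 6) : ℤ :=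
  if a ∈ W.support b then -det4 u (W.sigmaRow b a 0) (W.sigmaRow b a 1) (W.sigmaRow b a 2)
    (W.sigmaRow b a 3) else 0

theorem eval_clear (u : Fin 7 → Fin 4 → ℤ) (d : Factor) :
    eval (point u) (W.clear (d.val c)) = (d.val (W.clearVal u) : ℤ) := by
  have h : ∀ b a, eval (point u) (W.clear (c b a)) = (W.clearVal u b a : ℤ) := by
    intro b a
    simp only [clear, c, aeval_X, clearVal]
    split_ifs
    · rw [map_neg, sigma_eq, eval_extDet, Int.cast_neg]
    · simp
  refine (congrArg (eval (point u)) (Factor.map_val W.clear.toRingHom c d)).trans ?_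
  refine (Factor.map_val (eval (point u)) _ d).trans ?_
  refine Eq.trans ?_ (Factor.map_val (Int.castRingHom ℝ) _ d).symm
  congr 1
  funext b a
  exact h b a

theorem eval_bracket (u : Fin 7 → Fin 4 → ℤ) (b : Fin 2) :
    eval (point u) (W.bracket b) = (det4 u (W.corners b 0).castSucc (W.corners b 1).castSucc
      (W.corners b 2).castSucc (W.corners b 3).castSucc : ℤ) := by
  rw [bracket_eq, eval_extDet]

/-- Since `point` repeats the first entry of each particle, Cramer's rule makes this sum minus the
bracket times the first gauge entry. The numerators are therefore nonzero as soon as that entry and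
the brackets are. -/
theorem eval_clearNumer (u : Fin 7 → Fin 4 → ℤ) (b : Fin 2) :
    eval (point u) (W.clearNumer b) =
      (∑ a ∈ W.support b, W.clearVal u b a * u a.castSucc 0 : ℤ) := by
  rw [clearNumer, map_sum, Int.cast_sum]
  refine Finset.sum_congr rfl fun a ha => ?_
  rw [map_mul, map_neg, eval_X, sigma_eq, eval_extDet, clearVal, if_pos ha, Int.cast_mul,
    Int.cast_neg]
  simp [point]

/-- At the point `u` the brackets and the numerators are not zero. -/
def Regular (u : Fin 7 → Fin 4 → ℤ) : Prop :=
  ∀ b, det4 u (W.corners b 0).castSucc (W.corners b 1).castSucc (W.corners b 2).castSucc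
      (W.corners b 3).castSucc ≠ 0 ∧
    ∑ a ∈ W.support b, W.clearVal u b a * u a.castSucc 0 ≠ 0

instance (u : Fin 7 → Fin 4 → ℤ) : Decidable (W.Regular u) := by
  unfold Regular; infer_instance

theorem Regular.not_dvd {W : Diagram 2 6} {u : Fin 7 → Fin 4 → ℤ} (h : W.Regular u)
    {f : ZRing 2 6} (hf : eval (point u) f = 0) (b : Fin 2) :
    ¬f ∣ W.bracket b ∧ ¬f ∣ W.clearNumer b := by
  refine ⟨not_dvd_of_eval _ hf ?_, not_dvd_of_eval _ hf ?_⟩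
  · rw [eval_bracket]
    exact Int.cast_ne_zero.2 (h b).1
  · rw [eval_clearNumer]
    exact Int.cast_ne_zero.2 (h b).2

theorem Regular.bracket_ne_zero {W : Diagram 2 6} {u : Fin 7 → Fin 4 → ℤ} (h : W.Regular u)
    (b : Fin 2) : W.bracket b ≠ 0 := by
  intro h0
  have := W.eval_bracket u b
  rw [h0, map_zero] at this
  exact (h b).1 (by exact_mod_cast this.symm)

/-- The factor `d` occurs in the denominator, and `u` is a point of `d = 0` at which the other
factors, the brackets and the numerators are not zero. -/
def SimpleAt (u : Fin 7 → Fin 4 → ℤ) (d : Factor) : Prop :=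
  d ∈ W.factors ∧ d.val (W.clearVal u) = 0 ∧ W.Regular u ∧
    ∀ d' ∈ W.factors.erase d, d'.val (W.clearVal u) ≠ 0

instance (u : Fin 7 → Fin 4 → ℤ) (d : Factor) : Decidable (W.SimpleAt u d) := by
  unfold SimpleAt; infer_instance

/-- A single integral point of the hypersurface rules out every unwanted divisibility at once: a
multiple of the cleared minor would vanish there. -/
theorem SimpleAt.isSimplePole {W : Diagram 2 6} {u : Fin 7 → Fin 4 → ℤ} {b : Fin 2} {v : Fin 6}
    (h : W.SimpleAt u (W.boundaryFactor b v))
    (hp : Prime (W.clear ((W.boundaryFactor b v).val c))) : W.IsSimplePole b v := by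
  obtain ⟨h1, h2, h3, h4⟩ := h
  set d := W.boundaryFactor b v
  have h0 : eval (point u) (W.clear (d.val c)) = 0 := by rw [eval_clear, h2, Int.cast_zero]
  refine W.isSimplePole_of_prime (Q := ((W.factors.erase d).map (Factor.val c)).prod)
    (W.boundaryMinor_eq b v) (W.clears_val h3.bracket_ne_zero d) (W.clears_denom h3.bracket_ne_zero)
    ?_ hp (fun b => (h3.not_dvd h0 b).1) (fun b => (h3.not_dvd h0 b).2) (not_dvd_of_eval _ h0 ?_)
  · rw [denom_eq, ← List.prod_cons, ← List.map_cons]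
    exact ((List.perm_cons_erase h1).map _).prod_eq
  · rw [map_list_prod, map_list_prod, Ne, List.prod_eq_zero_iff, List.map_map, List.map_map]
    intro h5
    obtain ⟨d', hd', h6⟩ := List.mem_map.1 h5
    simp only [Function.comp_apply, eval_clear, Int.cast_eq_zero] at h6
    exact h4 d' hd' h6

/-! ## Simple and double poles of the admissible diagrams -/

theorem extDet_prime {i j k l : Fin 7} (h : [i, j, k, l].Nodup) : Prime (extDet i j k l) := by
  rw [← rename_det4]
  simp only [List.nodup_cons, List.mem_cons, List.not_mem_nil, or_false, not_or] at h
  obtain ⟨⟨h1, h2, h3⟩, ⟨h4, h5⟩, h6, -⟩ := h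
  exact prime_rename extVar_injective (det4_irreducible h1 h2 h3 h4 h5 h6).prime

theorem sigmaRow_nodup : ∀ W ∈ diagrams, ∀ b a,
    [W.sigmaRow b a 0, W.sigmaRow b a 1, W.sigmaRow b a 2, W.sigmaRow b a 3].Nodup := by
  decide +kernel

theorem clear_entry {W : Diagram 2 6} {b : Fin 2} {a : Fin 6} (ha : a ∈ W.support b) :
    W.clear ((Factor.entry b a).val c) = -W.sigma b a := by
  simp [clear, Factor.val, c, ha]

theorem prime_clear_entry {W : Diagram 2 6} (hW : W ∈ diagrams) {b : Fin 2} {a : Fin 6}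
    (ha : a ∈ W.support b) : Prime (W.clear ((Factor.entry b a).val c)) := by
  rw [clear_entry ha, sigma_eq]
  exact (extDet_prime (sigmaRow_nodup W hW b a)).neg

/-- The six particles on the moment curve, and the gauge vector `s`. -/
def momentData (s : Fin 4 → ℤ) (i : Fin 7) (μ : Fin 4) : ℤ :=
  if i = 6 then s μ else ((i : ℕ) ^ (μ : ℕ) : ℕ)

/-- The sum of the points of the moment curve at the vertices in the support of `b` other
than `v`. -/
def facePoint (W : Diagram 2 6) (b : Fin 2) (v : Fin 6) (μ : Fin 4) : ℤ :=
  ∑ t ∈ W.support b, if t = v then 0 else (((t + 2 : ℕ) * (t : ℕ) ^ (μ : ℕ) : ℕ) : ℤ)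

/-- All vertices of the support of `b` other than `v` support the other propagator. -/
def Doubled (W : Diagram 2 6) (b : Fin 2) (v : Fin 6) : Prop :=
  ∀ t ∈ W.support b, t = v ∨ t ∈ W.support (b + 1)

instance (W : Diagram 2 6) (b : Fin 2) (v : Fin 6) : Decidable (W.Doubled b v) := by
  unfold Doubled; infer_instance

/-- The gauge vector is a positive combination of the three `Z_t`, `t ∈ V_b`, `t ≠ v`, which is
precisely what kills the determinant of `c_{b,v}`. Four points of the moment curve are independent,
so the brackets survive, and the first gauge entry is the sum of the weights. The weights `t + 2`
are generic enough for the remaining factors. -/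
theorem simpleAt_entry : ∀ W ∈ diagrams, ∀ b, ∀ v ∈ W.support b, ¬W.Touches b v (b + 1) →
    ¬W.Doubled b v → W.SimpleAt (momentData (W.facePoint b v)) (.entry b v) := by
  decide +kernel

theorem isSimplePole_entry {W : Diagram 2 6} (hW : W ∈ diagrams) {b : Fin 2} {v : Fin 6}
    (hv : v ∈ W.support b) (ht : ¬W.Touches b v (b + 1)) (hd : ¬W.Doubled b v) :
    W.IsSimplePole b v := by
  have hb : W.boundaryFactor b v = .entry b v := if_neg ht
  have h := simpleAt_entry W hW b v hv ht hd
  rw [← hb] at h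
  exact h.isSimplePole (hb ▸ prime_clear_entry hW hv)

theorem extDet_comp_perm (i : Fin 4 → Fin 7) (π : Equiv.Perm (Fin 4)) :
    extDet (i 0) (i 1) (i 2) (i 3) ∣ extDet (i (π 0)) (i (π 1)) (i (π 2)) (i (π 3)) := by
  have h : ∀ i : Fin 4 → Fin 7, extDet (i 0) (i 1) (i 2) (i 3) =
      (Matrix.of fun r μ => (X (extVar (i r, μ)) : ZRing 2 6)).det := fun i => by
    rw [det_eq_det4]; rfl
  have h' := h fun r => i (π r)
  have h2 := Matrix.det_permute π (Matrix.of fun r μ => (X (extVar (i r, μ)) : ZRing 2 6))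
  rw [h', h]
  exact ⟨_, h2.trans (mul_comm _ _)⟩

/-- Let `v'` be the vertex of the other propagator that is not shared. Both `σ_{b,v}` and
`σ_{b+1,v'}` are determinants of `Z_*` and the three shared vertices, so they agree up to the order
of the rows, and both entries occur in the denominator. -/
theorem exists_twin_of_doubled : ∀ W ∈ diagrams, ∀ b, ∀ v ∈ W.support b, W.Doubled b v →
    ¬W.Touches b v (b + 1) ∧ W.Regular (momentData (W.facePoint b v)) ∧
    (Factor.entry b v).val (W.clearVal (momentData (W.facePoint b v))) = 0 ∧
    .entry b v ∈ W.factors ∧ ∃ v' ∈ W.support (b + 1),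
      .entry (b + 1) v' ∈ W.factors.erase (.entry b v) ∧
      ∃ π : Equiv.Perm (Fin 4), ∀ r, W.sigmaRow (b + 1) v' r = W.sigmaRow b v (π r) := by
  decide +kernel

theorem not_isSimplePoleOnComponent_of_doubled {W : Diagram 2 6} (hW : W ∈ diagrams) {b : Fin 2}
    {v : Fin 6} (hv : v ∈ W.support b) (hd : W.Doubled b v) :
    ¬W.IsSimplePoleOnComponent b v := by
  obtain ⟨ht, hr, h0, hm, v', hv', hm', π, hπ⟩ := exists_twin_of_doubled W hW b v hv hd
  have hb : W.boundaryFactor b v = .entry b v := if_neg ht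
  have hz : eval (point (momentData (W.facePoint b v))) (W.clear ((Factor.entry b v).val c)) = 0 := by
    rw [eval_clear, h0, Int.cast_zero]
  refine W.not_isSimplePoleOnComponent_of_sq_dvd (hb ▸ W.boundaryMinor_eq b v)
    (W.clears_val hr.bracket_ne_zero _) (W.clears_denom hr.bracket_ne_zero) ?_
    (prime_clear_entry hW hv) (fun b => (hr.not_dvd hz b).1) (fun b => (hr.not_dvd hz b).2)
  have h1 : W.clear ((Factor.entry b v).val c) ∣ W.clear ((Factor.entry (b + 1) v').val c) := by
    rw [clear_entry hv, clear_entry hv', neg_dvd, dvd_neg, sigma_eq, sigma_eq, hπ, hπ, hπ, hπ]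
    exact extDet_comp_perm _ π
  rw [denom_eq, ((List.perm_cons_erase hm).map _).prod_eq, List.map_cons, List.prod_cons,
    ((List.perm_cons_erase hm').map _).prod_eq, List.map_cons, List.prod_cons, map_mul, map_mul,
    pow_two]
  exact mul_dvd_mul_left _ (h1.mul_right _)

theorem prime_concurrency {ρ : Fin 7 → Fin 7} (hρ : Function.Injective ρ) :
    Prime (concurrency fun i μ => (X (extVar (ρ i, μ)) : ZRing 2 6)) := by
  have hinj : Function.Injective fun x : Fin 7 × Fin 4 => extVar (ρ x.1, x.2) := by
    intro x y h
    have := extVar_injective h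
    simp only [Prod.mk.injEq] at this
    exact Prod.ext (hρ this.1) this.2
  have h := prime_rename hinj concurrency_irreducible.prime
  have h2 := map_concurrency
    (rename (fun x : Fin 7 × Fin 4 => extVar (ρ x.1, x.2)) : _ →ₐ[ℝ] ZRing 2 6).toRingHom
    (genMat (Fin 7))
  simp only [genMat, AlgHom.toRingHom_eq_coe, RingHom.coe_coe, rename_X] at h2
  exact h2 ▸ h

/-- After clearing, the minor on an edge is the concurrency polynomial of the edge, the two opposite
edges and the gauge vector; `ρ` records which points play these roles. The signs from Cramer's rule
and from the exchange of two rows occur twice in each product and cancel. -/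
theorem prime_clear_edge {W : Diagram 2 6} {e : Fin 6} {b q : Fin 2} (ρ : Fin 7 → Fin 7)
    (hρ : Function.Injective ρ)
    (hs : e ∈ W.support b ∧ e + 1 ∈ W.support b ∧ e ∈ W.support q ∧ e + 1 ∈ W.support q)
    (h1 : ∀ r, W.sigmaRow b e r = ρ (![6, 1, 4, 5] r))
    (h2 : ∀ r, W.sigmaRow b (e + 1) r = ρ (![0, 6, 4, 5] r))
    (h3 : ∀ r, W.sigmaRow q e r = ρ (![6, 1, 2, 3] r))
    (h4 : ∀ r, W.sigmaRow q (e + 1) r = ρ (![0, 6, 2, 3] r)) :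
    Prime (W.clear ((Factor.edge e b q).val c)) := by
  have hswap : ∀ i j k l : Fin 7, extDet i j k l = -extDet j i k l := fun i j k l => by
    simp only [extDet, det4, det3, det2]; ring
  have hD : ∀ {b : Fin 2} {a : Fin 6}, a ∈ W.support b → W.clear (c b a) = -W.sigma b a :=
    fun ha => clear_entry ha
  have h := prime_concurrency hρ
  convert h using 1
  simp only [Factor.val, map_sub, map_mul, hD hs.1, hD hs.2.1, hD hs.2.2.1, hD hs.2.2.2, sigma_eq,
    h1, h2, h3, h4, concurrency_comp (fun i μ => (X (extVar (i, μ)) : ZRing 2 6)) ρ]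
  simp only [Matrix.cons_val, hswap (ρ 6) (ρ 1)]
  change _ = extDet _ _ _ _ * extDet _ _ _ _ - extDet _ _ _ _ * extDet _ _ _ _
  ring

/-- A gauge vector `∑ w_t Z_t` for the particles on the moment curve. -/
def combination (w : Fin 6 → ℤ) (μ : Fin 4) : ℤ := ∑ t : Fin 6, w t * ((t : ℕ) ^ (μ : ℕ) : ℕ)

theorem isSimplePole_edge_even : (diag 0 4 0 2).IsSimplePole 0 0 := by
  have hb : (diag 0 4 0 2).boundaryFactor 0 0 = .edge 0 0 1 := by decide +kernel
  -- Modulo `Z_4`, `Z_5` one has `-2 Z_2 + 8 Z_3 ≡ -Z_0 + 2 Z_1` on the moment curve. Both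
  -- propagators thus have coefficients in the ratio `-1 : 2` on the columns 0 and 1, and the edge
  -- minor vanishes.
  have h : (diag 0 4 0 2).SimpleAt (momentData (combination ![-1, 2, -2, 8, 0, 0]))
    ((diag 0 4 0 2).boundaryFactor 0 0) := by decide +kernel
  refine h.isSimplePole ?_
  rw [hb]
  exact prime_clear_edge id Function.injective_id (by decide) (by decide) (by decide) (by decide)
    (by decide)

theorem isSimplePole_edge_odd : (diag 1 5 1 3).IsSimplePole 0 1 := by
  have hb : (diag 1 5 1 3).boundaryFactor 0 1 = .edge 1 0 1 := by decide +kernel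
  -- Modulo `Z_5`, `Z_0` one has `8 Z_3 - 7 Z_4 ≡ 2 Z_1 + 2 Z_2`, which makes the coefficients on
  -- the columns 1 and 2 proportional.
  have h : (diag 1 5 1 3).SimpleAt (momentData (combination ![0, 2, 2, 8, -7, 0]))
    ((diag 1 5 1 3).boundaryFactor 0 1) := by decide +kernel
  refine h.isSimplePole ?_
  rw [hb]
  exact prime_clear_edge ![1, 2, 3, 4, 5, 0, 6] (by decide) (by decide) (by decide) (by decide)
    (by decide) (by decide)

end Diagram

/-! ## The bases of the diagrams and of their boundary diagrams -/

/-- The `2 × 2` minor in the columns `i`, `j`. -/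
def pl {R ι : Type*} [CommRing R] (A : Fin 2 → ι → R) (i j : ι) : R := A 0 i * A 1 j - A 0 j * A 1 i

theorem minor_eq_pl {R : Type*} [CommRing R] {n : ℕ} (A : Matrix (Fin 2) (Fin n) R)
    (I : Fin 2 ↪o Fin n) : minor A I = pl A (I 0) (I 1) := by
  simp [minor, Matrix.det_fin_two, pl]

theorem map_pl {R S ι : Type*} [CommRing R] [CommRing S] (θ : R →+* S) (A : Fin 2 → ι → R)
    (i j : ι) : θ (pl A i j) = pl (fun b a => θ (A b a)) i j := by simp [pl]

namespace Diagram

variable (W : Diagram 2 6)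

/-- A matrix with the zero pattern of `C(W)` and no vanishing minors beyond the identically vanishing
ones, with the second row depending on `y`. -/
def sample {R : Type*} [CommRing R] (y : Fin 6 → R) (b : Fin 2) (a : Fin 6) : R :=
  if a ∈ W.support b then if b = 0 then 1 else y a else 0

/-- The minor of `C(W)` in the columns `i`, `j` is not identically zero. -/
def BasisTest (i j : Fin 6) : Prop := pl (W.sample fun a => ((a : ℕ) + 1 : ℤ)) i j ≠ 0

/-- The minor of `C(W)` in the columns `i`, `j` is not identically zero on `c_{b,v} = 0`. -/
def EraseTest (b : Fin 2) (v i j : Fin 6) : Prop :=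
  pl (fun b' a => if b' = b ∧ a = v then 0 else W.sample (fun a => ((a : ℕ) + 1 : ℤ)) b' a) i j ≠ 0

/-- The minor of `C(W)` in the columns `i`, `j` is not identically zero on the boundary
diagram `∂_{b,v}(W)`. -/
def BoundaryTest (b : Fin 2) (v i j : Fin 6) : Prop :=
  if W.Touches b v (b + 1) then W.BasisTest i j ∧
    ¬(i = W.edgeAt b v ∧ j = W.edgeAt b v + 1 ∨ j = W.edgeAt b v ∧ i = W.edgeAt b v + 1)
  else W.EraseTest b v i j

instance (i j : Fin 6) : Decidable (W.BasisTest i j) := by unfold BasisTest; infer_instance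
instance (b : Fin 2) (v i j : Fin 6) : Decidable (W.EraseTest b v i j) := by
  unfold EraseTest; infer_instance
instance (b : Fin 2) (v i j : Fin 6) : Decidable (W.BoundaryTest b v i j) := by
  unfold BoundaryTest; infer_instance

/-- The entries `a + 1` of the second row are distinct and positive, so the two terms of a minor
never cancel: it vanishes only if each term does. This lets one integer matrix decide which minors
vanish identically. -/
theorem mul_eq_zero_of_pl_eq_zero {C : Fin 2 → Fin 6 → ℤ} (h0 : ∀ a, C 0 a = 0 ∨ C 0 a = 1)
    (h1 : ∀ a, C 1 a = 0 ∨ C 1 a = (a : ℕ) + 1) {i j : Fin 6} (hij : i < j) (h : pl C i j = 0) :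
    C 0 i * C 1 j = 0 ∧ C 0 j * C 1 i = 0 := by
  have : (i : ℕ) < j := hij
  unfold pl at h
  rcases h0 i with h2 | h2 <;> rcases h0 j with h3 | h3 <;> rcases h1 i with h4 | h4 <;>
    rcases h1 j with h5 | h5 <;> rw [h2, h3, h4, h5] at h ⊢ <;> omega

theorem sample_zero_row (y : Fin 6 → ℤ) (a : Fin 6) :
    W.sample y 0 a = 0 ∨ W.sample y 0 a = 1 := by
  by_cases h : a ∈ W.support 0 <;> simp [sample, h]

theorem sample_one_row (y : Fin 6 → ℤ) (a : Fin 6) :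
    W.sample y 1 a = 0 ∨ W.sample y 1 a = y a := by
  by_cases h : a ∈ W.support 1 <;> simp [sample, h]

/-- The evaluation of `C(W)` at a sample matrix. -/
theorem eval_pl_matC {x : Fin 2 → Fin 6 → ℤ} {C : Fin 2 → Fin 6 → ℤ}
    (h : ∀ b a, C b a = if a ∈ W.support b then x b a else 0) (i j : Fin 6) :
    eval (fun p : Fin 2 × Fin 6 => (x p.1 p.2 : ℝ)) (pl W.matC i j) = (pl C i j : ℤ) := by
  refine (map_pl (eval _) _ i j).trans (Eq.trans ?_ (map_pl (Int.castRingHom ℝ) C i j).symm)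
  congr 1
  funext b a
  rw [h, matC]
  split_ifs <;> simp [c]

theorem dvd_pl_matC {d : CRing 2 6} {C : Fin 2 → Fin 6 → ℤ} (hC : ∀ b a, C b a = 0 → d ∣ W.matC b a)
    {i j : Fin 6} (h : C 0 i * C 1 j = 0 ∧ C 0 j * C 1 i = 0) : d ∣ pl W.matC i j := by
  have h1 : ∀ a a', C 0 a * C 1 a' = 0 → d ∣ W.matC 0 a * W.matC 1 a' := fun a a' h =>
    (mul_eq_zero.1 h).elim (fun h => (hC _ _ h).mul_right _) fun h => (hC _ _ h).mul_left _
  exact dvd_sub (h1 _ _ h.1) (h1 _ _ h.2)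

theorem pl_matC_ne_zero_iff {i j : Fin 6} (hij : i < j) :
    pl W.matC i j ≠ 0 ↔ W.BasisTest i j := by
  constructor
  · intro h h1
    refine h (zero_dvd_iff.1 (W.dvd_pl_matC (fun b a h2 => ?_) (mul_eq_zero_of_pl_eq_zero
      (W.sample_zero_row _) (W.sample_one_row _) hij h1)))
    rw [matC, if_neg]
    intro ha
    simp only [sample, ha, if_true] at h2
    split_ifs at h2
    · exact one_ne_zero h2
    · omega
  · intro h h1
    have h2 := W.eval_pl_matC (C := W.sample fun a => ((a : ℕ) + 1 : ℤ))
      (x := fun b a => if b = 0 then 1 else ((a : ℕ) + 1 : ℤ)) (fun b a => rfl) i j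
    rw [h1, map_zero] at h2
    exact h (by exact_mod_cast h2.symm)

theorem entry_dvd_pl_matC_iff {b : Fin 2} {v i j : Fin 6} (hij : i < j) :
    c b v ∣ pl W.matC i j ↔ ¬W.EraseTest b v i j := by
  constructor
  · rintro ⟨q, hq⟩ h1
    have h2 := W.eval_pl_matC (C := fun b' a => if b' = b ∧ a = v then 0 else
        W.sample (fun a => ((a : ℕ) + 1 : ℤ)) b' a)
      (x := fun b' a => if b' = b ∧ a = v then 0 else if b' = 0 then 1 else ((a : ℕ) + 1 : ℤ))
      (fun b a => by simp only [sample]; split_ifs <;> rfl) i j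
    rw [hq, map_mul, c, eval_X] at h2
    simp only [and_self, if_true, Int.cast_zero, zero_mul] at h2
    exact h1 (by exact_mod_cast h2.symm)
  · intro h1
    have h1 := not_ne_iff.1 h1
    refine W.dvd_pl_matC (C := fun b' a => if b' = b ∧ a = v then 0 else
        W.sample (fun a => ((a : ℕ) + 1 : ℤ)) b' a) (fun b' a h2 => ?_)
      (mul_eq_zero_of_pl_eq_zero (fun a => ?_) (fun a => ?_) hij h1)
    · by_cases h3 : b' = b ∧ a = v
      · rw [matC]
        split_ifs
        · rw [h3.1, h3.2]
        · exact dvd_zero _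
      · rw [matC, if_neg]
        · exact dvd_zero _
        · intro ha
          simp only [sample, ha, h3, if_true, if_false] at h2
          split_ifs at h2
          · exact one_ne_zero h2
          · omega
    · split_ifs
      · exact Or.inl rfl
      · exact W.sample_zero_row _ _
    · split_ifs
      · exact Or.inl rfl
      · exact W.sample_one_row _ _

/-- On the locus where the columns `e` and `e + 1` are parallel, the only minor lost is the one in
these two columns, which is the edge minor up to sign. -/
theorem edgeMinor_dvd_pl_matC_iff {e : Fin 6} {b : Fin 2}
    (he : ∀ b, e ∈ W.support b ∧ e + 1 ∈ W.support b) {i j : Fin 6} (hij : i < j) :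
    edgeMinor e b (b + 1) ∣ pl W.matC i j ↔
      ¬(W.BasisTest i j ∧ ¬(i = e ∧ j = e + 1 ∨ j = e ∧ i = e + 1)) := by
  have hM : ∀ b, W.matC b e = c b e ∧ W.matC b (e + 1) = c b (e + 1) := fun b =>
    ⟨if_pos (he b).1, if_pos (he b).2⟩
  constructor
  · rintro ⟨q, hq⟩ ⟨h1, h2⟩
    -- The column `e + 1` is made equal to the column `e`, so the edge minor vanishes. All other
    -- second-row values stay distinct and nonzero, so no further minor does.
    let y : Fin 6 → ℤ := fun a => if a = e + 1 then ((e : ℕ) + 1 : ℤ) else ((a : ℕ) + 1 : ℤ)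
    have h3 := W.eval_pl_matC (C := W.sample y)
      (x := fun b a => if b = 0 then 1 else y a) (fun b a => rfl) i j
    have h4 : pl (W.sample y) i j = 0 := by
      have : eval (fun p : Fin 2 × Fin 6 => (((if p.1 = 0 then 1 else y p.2 : ℤ)) : ℝ))
          (edgeMinor e b (b + 1)) = 0 := by
        fin_cases b <;> simp [edgeMinor, c, y]
      rw [hq, map_mul, this, zero_mul] at h3
      exact_mod_cast h3.symm
    have hy : y i ≠ y j := by
      simp only [y]
      split_ifs with h5 h6 h6 <;> omega
    have hy0 : ∀ a, y a ≠ 0 := by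
      intro a
      simp only [y]
      split_ifs <;> omega
    apply h1
    revert h4
    simp only [pl, sample]
    have := hy0 i
    have := hy0 j
    split_ifs <;> simp_all; omega
  · intro h
    by_cases h1 : i = e ∧ j = e + 1 ∨ j = e ∧ i = e + 1
    · have : pl W.matC i j = edgeMinor e b (b + 1) ∨ pl W.matC i j = -edgeMinor e b (b + 1) := by
        rcases h1 with ⟨rfl, rfl⟩ | ⟨rfl, rfl⟩ <;> fin_cases b <;>
          simp only [pl, hM, edgeMinor, Fin.zero_eta, Fin.mk_one, zero_add, Fin.isValue,
            show (1 : Fin 2) + 1 = 0 from rfl]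
        · left; ring
        · right; ring
        · right; ring
        · left; ring
      rcases this with h | h
      · rw [h]
      · rw [h]; exact (dvd_neg).2 dvd_rfl
    · have h2 : ¬W.BasisTest i j := fun h2 => h ⟨h2, h1⟩
      rw [not_ne_iff.1 (mt (W.pl_matC_ne_zero_iff hij).1 h2)]
      exact dvd_zero _

theorem Touches.mem_support {W : Diagram 2 6} {b q : Fin 2} {v : Fin 6} (h : W.Touches b v q) :
    ∀ b', W.edgeAt b v ∈ W.support b' ∧ W.edgeAt b v + 1 ∈ W.support b' := by
  have hinc : ∀ b', W.Incident (W.edgeAt b v) b' →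
      W.edgeAt b v ∈ W.support b' ∧ W.edgeAt b v + 1 ∈ W.support b' := by
    intro b' h'
    rcases h' with h' | h' <;> simp [support, ← h']
  have hq := h.eq_add_one
  have : W.Incident (W.edgeAt b v) b ∧ W.Incident (W.edgeAt b v) (b + 1) := by
    rw [← hq]
    rcases h with ⟨-, h⟩ | ⟨-, h⟩
    · exact ⟨h.1, h.2.1⟩
    · exact ⟨h.2.1, h.1⟩
  intro b'
  have hb' : b' = b ∨ b' = b + 1 := by omega
  rcases hb' with rfl | rfl
  · exact hinc _ this.1
  · exact hinc _ this.2

theorem mem_bases_iff (I : Fin 2 ↪o Fin 6) : I ∈ W.bases ↔ W.BasisTest (I 0) (I 1) := by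
  rw [← W.pl_matC_ne_zero_iff (I.strictMono (by decide)), ← minor_eq_pl]
  rfl

/-- Vanishing in the quotient ring is divisibility by the boundary minor, which the two preceding
criteria decide. -/
theorem minor_boundaryMat_ne_zero_iff (b : Fin 2) (v : Fin 6) (I : Fin 2 ↪o Fin 6) :
    minor (W.boundaryMat b v) I ≠ 0 ↔ W.BoundaryTest b v (I 0) (I 1) := by
  have hI : I 0 < I 1 := I.strictMono (by decide)
  have h1 : minor (W.boundaryMat b v) I =
      Ideal.Quotient.mk (Ideal.span {W.boundaryMinor b v}) (pl W.matC (I 0) (I 1)) := by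
    exact (minor_eq_pl _ I).trans (map_pl (Ideal.Quotient.mk (Ideal.span {W.boundaryMinor b v}))
      W.matC (I 0) (I 1)).symm
  rw [h1, Ne, Ideal.Quotient.eq_zero_iff_mem, Ideal.mem_span_singleton, boundaryMinor_eq,
    boundaryFactor, BoundaryTest]
  split_ifs with h
  · exact (not_congr (W.edgeMinor_dvd_pl_matC_iff h.mem_support hI)).trans not_not
  · exact (not_congr (W.entry_dvd_pl_matC_iff hI)).trans not_not

end Diagram

open Filter Topology

/-! ## Cells of the Grassmannian `G(2, n)` and their closures -/

section Cells

variable {n : ℕ}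

theorem rank_eq_two_iff (A : Matrix (Fin 2) (Fin n) ℝ) : A.rank = 2 ↔ ∃ i j, i < j ∧ pl A i j ≠ 0 := by
  constructor
  · intro h
    by_contra! h0
    have h1 : ∀ i j, pl A i j = 0 := by
      intro i j
      rcases lt_trichotomy i j with h | rfl | h
      · exact h0 i j h
      · simp only [pl]; ring
      · have := h0 j i h
        simp only [pl] at this ⊢
        linarith
    have hli : LinearIndependent ℝ A.row := by
      rw [linearIndependent_iff_card_eq_finrank_span, ← h, Matrix.rank_eq_finrank_span_row] at *
      simpa [Set.finrank] using h.symm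
    rw [Fintype.linearIndependent_iff] at hli
    have h2 : ∀ i, A 0 i = 0 := by
      intro i
      refine neg_eq_zero.1 (hli ![A 1 i, -A 0 i] ?_ 1)
      funext j
      have := h1 i j
      simp only [pl] at this
      simp [Matrix.row]
      linarith
    have h3 := hli ![1, 0] (by funext j; simp [Matrix.row, h2]) 0
    simp at h3
  · rintro ⟨i, j, -, h⟩
    have hli : LinearIndependent ℝ A.row := by
      rw [Fintype.linearIndependent_iff]
      intro g hg
      have hi := congrFun hg i
      have hj := congrFun hg j
      simp only [Matrix.row, Fin.sum_univ_two, Pi.add_apply, Pi.smul_apply, smul_eq_mul,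
        Pi.zero_apply] at hi hj
      have e0 : g 0 * pl A i j = 0 := by simp only [pl]; linear_combination A 1 j * hi - A 1 i * hj
      have e1 : g 1 * pl A i j = 0 := by simp only [pl]; linear_combination A 0 i * hj - A 0 j * hi
      intro b
      fin_cases b
      · exact (mul_eq_zero.1 e0).resolve_right h
      · exact (mul_eq_zero.1 e1).resolve_right h
    simpa using hli.rank_matrix

/-- The order embedding with the values `i < j`. -/
def pairEmb (i j : Fin n) (h : i < j) : Fin 2 ↪o Fin n :=
  OrderEmbedding.ofStrictMono ![i, j] (by
    intro a b hab
    fin_cases a <;> fin_cases b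
    · exact absurd hab (lt_irrefl _)
    · exact h
    · exact absurd hab (by decide)
    · exact absurd hab (lt_irrefl _))

theorem pl_mul (g : Matrix (Fin 2) (Fin 2) ℝ) (A : Matrix (Fin 2) (Fin n) ℝ) (i j : Fin n) :
    pl (g * A) i j = g.det * pl A i j := by
  simp only [pl, Matrix.mul_apply, Fin.sum_univ_two, Matrix.det_fin_two]
  ring

/-- The cell whose bases are the pairs `i < j` with `β i j`. -/
def patCell (β : Fin n → Fin n → Prop) : Set (Grassmannian 2 n) :=
  cell {I : Fin 2 ↪o Fin n | β (I 0) (I 1)}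

/-- A totally nonnegative matrix with the bases `β`. -/
def HasPattern (β : Fin n → Fin n → Prop) (A : Matrix (Fin 2) (Fin n) ℝ) : Prop :=
  ∀ i j, i < j → 0 ≤ pl A i j ∧ (pl A i j ≠ 0 ↔ β i j)

theorem mem_patCell {β : Fin n → Fin n → Prop} {x : Grassmannian 2 n} :
    x ∈ patCell β ↔ ∃ A : FullRank 2 n, toGr A = x ∧ HasPattern β A.1 := by
  constructor
  · rintro ⟨A, hA, h1, h2⟩
    refine ⟨A, hA, fun i j hij => ⟨?_, ?_⟩⟩
    · exact (h1 (pairEmb i j hij)).trans_eq (minor_eq_pl _ _)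
    · have := h2 (pairEmb i j hij)
      rw [minor_eq_pl] at this
      exact this
  · rintro ⟨A, hA, h⟩
    refine ⟨A, hA, fun I => ?_, fun I => ?_⟩
    · exact (h _ _ (I.strictMono (by decide))).1.trans_eq (minor_eq_pl _ _).symm
    · rw [minor_eq_pl]
      exact (h _ _ (I.strictMono (by decide))).2

theorem cell_eq_patCell (𝓑 : Set (Fin 2 ↪o Fin n)) :
    cell 𝓑 = patCell fun i j => ∃ h : i < j, pairEmb i j h ∈ 𝓑 := by
  unfold patCell
  congr 1
  ext I
  have hI : I 0 < I 1 := I.strictMono (by decide)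
  have : pairEmb (I 0) (I 1) hI = I := by
    ext b; fin_cases b <;> rfl
  simp [this]

theorem patCell_congr {β β' : Fin n → Fin n → Prop} (h : ∀ i j, i < j → (β i j ↔ β' i j)) :
    patCell β = patCell β' := by
  unfold patCell
  congr 1
  ext I
  exact h _ _ (I.strictMono (by decide))

theorem toGr_eq_iff {A B : FullRank 2 n} :
    toGr A = toGr B ↔ ∃ g : GL (Fin 2) ℝ, B.1 = (g : Matrix (Fin 2) (Fin 2) ℝ) * A.1 :=
  Quotient.eq

theorem continuous_toGr : Continuous (toGr : FullRank 2 n → Grassmannian 2 n) :=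
  continuous_quotient_mk'

theorem isClosed_pl_eq_zero (i j : Fin n) :
    IsClosed {x : Grassmannian 2 n | ∀ A, toGr A = x → pl A.1 i j = 0} := by
  have hq : IsQuotientMap (toGr : FullRank 2 n → Grassmannian 2 n) := isQuotientMap_quot_mk
  rw [← hq.isClosed_preimage]
  have : (toGr : FullRank 2 n → Grassmannian 2 n) ⁻¹'
      {x : Grassmannian 2 n | ∀ A, toGr A = x → pl A.1 i j = 0} = {A | pl A.1 i j = 0} := by
    ext A
    refine ⟨fun h => h A rfl, fun h B hB => ?_⟩
    obtain ⟨g, hg⟩ := toGr_eq_iff.1 hB.symm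
    rw [hg, pl_mul]
    exact mul_eq_zero_of_right _ h
  rw [this]
  refine isClosed_eq ?_ continuous_const
  have h : ∀ b a, Continuous fun A : FullRank 2 n => A.1 b a := fun b a =>
    (continuous_apply_apply b a).comp continuous_subtype_val
  exact ((h 0 i).mul (h 1 j)).sub ((h 0 j).mul (h 1 i))

/-- The vanishing of a minor does not depend on the representing matrix and is a closed condition. A
minor that is zero throughout a cell is therefore zero on its closure. -/
theorem pattern_le_of_subset_closure {β β' : Fin n → Fin n → Prop} (hne : (patCell β').Nonempty)
    (h : patCell β' ⊆ closure (patCell β)) {i j : Fin n} (hij : i < j) (hb : β' i j) : β i j := by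
  by_contra hb'
  obtain ⟨x, hx⟩ := hne
  have h1 : patCell β ⊆ {x : Grassmannian 2 n | ∀ A, toGr A = x → pl A.1 i j = 0} := by
    intro y hy B hB
    obtain ⟨A, hA, hp⟩ := mem_patCell.1 hy
    obtain ⟨g, hg⟩ := toGr_eq_iff.1 (hA.trans hB.symm)
    rw [hg, pl_mul]
    exact mul_eq_zero_of_right _ (not_ne_iff.1 fun h => hb' ((hp i j hij).2.1 h))
  have h2 := closure_minimal h1 (isClosed_pl_eq_zero i j) (h hx)
  obtain ⟨A, hA, hp⟩ := mem_patCell.1 hx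
  exact (hp i j hij).2.2 hb (h2 A hA)

theorem mem_closure_of_path {C : Set (Grassmannian 2 n)} (A : FullRank 2 n)
    (F : ℝ → Matrix (Fin 2) (Fin n) ℝ) (hF : Continuous F) (h0 : F 0 = A.1)
    (h : ∀ᶠ ε in 𝓝[>] (0 : ℝ), ∃ hr : (F ε).rank = 2, toGr ⟨F ε, hr⟩ ∈ C) :
    toGr A ∈ closure C := by
  rw [mem_closure_iff]
  intro O hO hAO
  obtain ⟨V, hV, hVO⟩ := isOpen_induced_iff.1 (hO.preimage (continuous_toGr (n := n)))
  have hA : F 0 ∈ V := by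
    rw [h0]
    have : A ∈ Subtype.val ⁻¹' V := by rw [hVO]; exact hAO
    exact this
  have h1 : ∀ᶠ ε in 𝓝[>] (0 : ℝ), F ε ∈ V :=
    nhdsWithin_le_nhds (hF.continuousAt.eventually (hV.mem_nhds hA))
  obtain ⟨ε, h2, hr, h3⟩ := (h1.and h).exists
  refine ⟨_, ?_, h3⟩
  have : (⟨F ε, hr⟩ : FullRank 2 n) ∈ Subtype.val ⁻¹' V := h2
  rw [hVO] at this
  exact this

/-- Adding to the columns in `T` the `ε`-multiple of the column `k`, scaled such that the operation
is linear in the column. -/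
def shear (A : Matrix (Fin 2) (Fin n) ℝ) (T : Finset (Fin n)) (k : Fin n) (ε : ℝ) :
    Matrix (Fin 2) (Fin n) ℝ :=
  fun b a => if a ∈ T then A b a + ε * (pl A a k * A b k) else A b a

/-- The sign of the minor in the columns `a`, `b` of a totally nonnegative matrix with the
bases `β`. -/
def plSign (β : Fin n → Fin n → Prop) [∀ i j, Decidable (β i j)] (a b : Fin n) : ℤ :=
  if a < b then if β a b then 1 else 0 else if b < a then if β b a then -1 else 0 else 0

theorem exists_pl_eq_plSign_mul {β : Fin n → Fin n → Prop} [∀ i j, Decidable (β i j)]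
    {A : Matrix (Fin 2) (Fin n) ℝ} (h : HasPattern β A) (a b : Fin n) :
    ∃ r : ℝ, 0 < r ∧ pl A a b = plSign β a b * r := by
  have hanti : pl A a b = -pl A b a := by simp only [pl]; ring
  unfold plSign
  rcases lt_trichotomy a b with h1 | rfl | h1
  · obtain ⟨h2, h3⟩ := h a b h1
    rw [if_pos h1]
    split_ifs with h4
    · exact ⟨_, lt_of_le_of_ne h2 (h3.2 h4).symm, by simp⟩
    · exact ⟨1, one_pos, by simpa using mt h3.1 h4⟩
  · exact ⟨1, one_pos, by simp [pl]⟩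
  · obtain ⟨h2, h3⟩ := h b a h1
    rw [if_neg h1.le.not_gt, if_pos h1]
    split_ifs with h4
    · exact ⟨_, lt_of_le_of_ne h2 (h3.2 h4).symm, by simp [hanti]⟩
    · exact ⟨1, one_pos, by simpa [hanti] using mt h3.1 h4⟩

/-- The sign of the change of the minor in the columns `i`, `j` under a shear. -/
def shearSign (β : Fin n → Fin n → Prop) [∀ i j, Decidable (β i j)] (T : Finset (Fin n))
    (k i j : Fin n) : ℤ :=
  if i ∈ T then if j ∈ T then 0 else plSign β i k * plSign β k j
  else if j ∈ T then plSign β j k * plSign β i k else 0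

/-- A combinatorial condition under which a shear changes the bases `β'` into `β`. -/
def Shears (β' β : Fin n → Fin n → Prop) [∀ i j, Decidable (β' i j)] (T : Finset (Fin n))
    (k : Fin n) : Prop :=
  ∀ i j, i < j → (β' i j → β i j) ∧
    (¬β' i j → 0 ≤ shearSign β' T k i j ∧ (β i j ↔ shearSign β' T k i j ≠ 0))

instance (β' β : Fin n → Fin n → Prop) [∀ i j, Decidable (β' i j)] [∀ i j, Decidable (β i j)]
    (T : Finset (Fin n)) (k : Fin n) : Decidable (Shears β' β T k) := by
  unfold Shears; infer_instance

/-- On the columns in `T` the shear is the unimodular map `x ↦ x + ε det(x, A_k) A_k`. Minors with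
both columns or neither column in `T` do not change, and mixed ones change exactly linearly in `ε`.
Positive minors stay positive for small `ε`; for vanishing ones the sign of the linear coefficient
decides, and it is determined by the bases. -/
theorem shear_hasPattern {β' β : Fin n → Fin n → Prop} [∀ i j, Decidable (β' i j)]
    {T : Finset (Fin n)} {k : Fin n} (h : Shears β' β T k) {A : Matrix (Fin 2) (Fin n) ℝ}
    (hA : HasPattern β' A) : ∀ᶠ ε in 𝓝[>] (0 : ℝ), HasPattern β (shear A T k ε) := by
  have key : ∀ i j, ∀ᶠ ε in 𝓝[>] (0 : ℝ), i < j →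
      0 ≤ pl (shear A T k ε) i j ∧ (pl (shear A T k ε) i j ≠ 0 ↔ β i j) := by
    intro i j
    by_cases hij : i < j
    swap
    · exact Eventually.of_forall fun ε h => absurd h hij
    set δ : ℝ := if i ∈ T then if j ∈ T then 0 else pl A i k * pl A k j
      else if j ∈ T then pl A j k * pl A i k else 0 with hδ
    have e : ∀ ε, pl (shear A T k ε) i j = pl A i j + ε * δ := by
      intro ε
      rw [hδ]
      by_cases hi : i ∈ T <;> by_cases hj : j ∈ T <;> simp only [pl, shear, hi, hj, if_true,
        if_false] <;> ring
    simp only [e]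
    obtain ⟨h1, h2⟩ := h i j hij
    obtain ⟨h3, h4⟩ := hA i j hij
    by_cases hb : β' i j
    · have hpos : 0 < pl A i j := lt_of_le_of_ne h3 (h4.2 hb).symm
      have hc : ContinuousAt (fun ε : ℝ => pl A i j + ε * δ) 0 := by fun_prop
      filter_upwards [nhdsWithin_le_nhds (hc.eventually (lt_mem_nhds (by simpa using hpos)))]
        with ε hε _
      exact ⟨hε.le, ⟨fun _ => h1 hb, fun _ => hε.ne'⟩⟩
    · obtain ⟨h5, h6⟩ := h2 hb
      have h0 : pl A i j = 0 := not_ne_iff.1 (mt h4.1 hb)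
      obtain ⟨r1, hr1, e1⟩ := exists_pl_eq_plSign_mul hA i k
      obtain ⟨r2, hr2, e2⟩ := exists_pl_eq_plSign_mul hA k j
      obtain ⟨r3, hr3, e3⟩ := exists_pl_eq_plSign_mul hA j k
      have hs : ∃ r : ℝ, 0 < r ∧ δ = shearSign β' T k i j * r := by
        rw [hδ, shearSign]
        split_ifs
        · exact ⟨1, one_pos, by simp⟩
        · exact ⟨r1 * r2, mul_pos hr1 hr2, by rw [e1, e2]; push_cast; ring⟩
        · exact ⟨r3 * r1, mul_pos hr3 hr1, by rw [e1, e3]; push_cast; ring⟩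
        · exact ⟨1, one_pos, by simp⟩
      obtain ⟨r, hr, hs⟩ := hs
      filter_upwards [self_mem_nhdsWithin] with ε hε _
      have hε : 0 < ε := hε
      rw [h0, zero_add, hs, h6]
      exact ⟨mul_nonneg hε.le (mul_nonneg (by exact_mod_cast h5) hr.le), by simp [hε.ne', hr.ne']⟩
  have := eventually_all.2 fun i => eventually_all.2 (key i)
  exact this

theorem patCell_subset_closure_of_shears {β' β : Fin n → Fin n → Prop} [∀ i j, Decidable (β' i j)]
    {T : Finset (Fin n)} {k : Fin n} (h : Shears β' β T k) : patCell β' ⊆ closure (patCell β) := by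
  intro x hx
  obtain ⟨A, rfl, hA⟩ := mem_patCell.1 hx
  refine mem_closure_of_path A (shear A.1 T k) ?_ ?_ ?_
  · refine continuous_matrix fun b a => ?_
    unfold shear
    split_ifs <;> fun_prop
  · funext b a
    simp [shear]
  · obtain ⟨i, j, hij, hne⟩ := (rank_eq_two_iff A.1).1 A.2
    filter_upwards [shear_hasPattern h hA] with ε hε
    have hr : (shear A.1 T k ε).rank = 2 := (rank_eq_two_iff _).2
      ⟨i, j, hij, (hε i j hij).2.2 ((h i j hij).1 ((hA i j hij).2.1 hne))⟩
    exact ⟨hr, mem_patCell.2 ⟨_, rfl, hε⟩⟩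

end Cells

/-! ## The dimension of a cell is well defined -/

/-- The transition map between two parametrizations is differentiable with a differentiable left
inverse, so its derivative is injective by the chain rule. -/
theorem HasDimension.le {k n : ℕ} {B : Set (Grassmannian k n)} {d d' : ℕ} (h : HasDimension B d)
    (h' : HasDimension B d') : d ≤ d' := by
  obtain ⟨φ, ψ, h1, h2, h3, h4⟩ := h
  obtain ⟨φ', ψ', h1', h2', h3', h4'⟩ := h'
  set f : EuclideanSpace ℝ (Fin d) → EuclideanSpace ℝ (Fin d') := fun x => ψ' fun i j => (φ x).1 i j
    with hf
  set g : EuclideanSpace ℝ (Fin d') → EuclideanSpace ℝ (Fin d) := fun y => ψ fun i j => (φ' y).1 i j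
    with hg
  have hgf : ∀ x, g (f x) = x := by
    intro x
    refine (h2 _ (h1' _) x).2 ?_
    exact ((h2' _ (h1 x) (f x)).1 rfl).symm
  have hfd : ∀ x, DifferentiableAt ℝ f x := fun x =>
    ((h4' _ (h1 x)).comp x h3.contDiffAt).differentiableAt (by simp)
  have hgd : ∀ y, DifferentiableAt ℝ g y := fun y =>
    ((h4 _ (h1' y)).comp y h3'.contDiffAt).differentiableAt (by simp)
  have hid : (fderiv ℝ g (f 0)).comp (fderiv ℝ f 0) = ContinuousLinearMap.id ℝ _ := by
    rw [← fderiv_comp (0 : EuclideanSpace ℝ (Fin d)) (hgd _) (hfd _),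
      show g ∘ f = id from funext hgf, fderiv_id]
  have hinj : Function.Injective (fderiv ℝ f 0).toLinearMap := by
    intro x y hxy
    have h5 := congrArg (fderiv ℝ g (f 0)) hxy
    have h6 := fun z => DFunLike.congr_fun hid z
    simp only [ContinuousLinearMap.comp_apply, ContinuousLinearMap.id_apply] at h6
    exact (h6 x).symm.trans (h5.trans (h6 y))
  simpa using LinearMap.finrank_le_finrank_of_injective hinj

theorem HasDimension.eq {k n : ℕ} {B : Set (Grassmannian k n)} {d d' : ℕ} (h : HasDimension B d)
    (h' : HasDimension B d') : d = d' := le_antisymm (h.le h') (h'.le h)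

/-! ### From global coordinates to an open ball -/

section Coordinates

variable {n : ℕ}

/-- A cell is an open ball if it has global coordinates. -/
theorem hasDimension_of_coordinates {ι : Type*} [Fintype ι] {β : Fin n → Fin n → Prop}
    (hβ : ∃ i j, i < j ∧ β i j) (φ : (ι → ℝ) → Fin 2 → Fin n → ℝ)
    (ψ : (Fin 2 → Fin n → ℝ) → ι → ℝ) (h1 : ∀ x, HasPattern β (φ x)) (h2 : ∀ x, ψ (φ x) = x)
    (h3 : ∀ (g : Matrix (Fin 2) (Fin 2) ℝ) (A : Matrix (Fin 2) (Fin n) ℝ), g.det ≠ 0 →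
      ψ (g * A : Matrix (Fin 2) (Fin n) ℝ) = ψ A)
    (h4 : ∀ A : Matrix (Fin 2) (Fin n) ℝ, HasPattern β A →
      ∃ g : Matrix (Fin 2) (Fin 2) ℝ, g.det ≠ 0 ∧ A = g * Matrix.of (φ (ψ A)))
    (h5 : ContDiff ℝ ∞ φ)
    (h6 : ∀ A, (∀ i j, i < j → (pl A i j ≠ 0 ↔ β i j)) → ContDiffAt ℝ ∞ ψ A) {d : ℕ}
    (hd : d = Fintype.card ι) : HasDimension (patCell β) d := by
  have hr : ∀ x, Matrix.rank (φ x : Matrix (Fin 2) (Fin n) ℝ) = 2 := by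
    intro x
    obtain ⟨i, j, hij, hb⟩ := hβ
    exact (rank_eq_two_iff _).2 ⟨i, j, hij, (h1 x i j hij).2.2 hb⟩
  have hrep : ∀ A : FullRank 2 n, toGr A ∈ patCell β → ∃ (A' : FullRank 2 n)
      (g : Matrix (Fin 2) (Fin 2) ℝ), g.det ≠ 0 ∧ A.1 = g * A'.1 ∧ HasPattern β A'.1 ∧
        toGr A' = toGr A := by
    intro A hA
    obtain ⟨A', hA', hp⟩ := mem_patCell.1 hA
    obtain ⟨g, hg⟩ := toGr_eq_iff.1 hA'
    exact ⟨A', g, (Matrix.isUnit_iff_isUnit_det _).1 g.isUnit |>.ne_zero, hg, hp, hA'⟩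
  have hgr : ∀ (A A' : FullRank 2 n) (g : Matrix (Fin 2) (Fin 2) ℝ), g.det ≠ 0 → A.1 = g * A'.1 →
      toGr A' = toGr A := by
    intro A A' g hg h
    exact toGr_eq_iff.2 ⟨Matrix.GeneralLinearGroup.mkOfDetNeZero g hg, h⟩
  let e : EuclideanSpace ℝ (Fin d) ≃L[ℝ] (ι → ℝ) :=
    ContinuousLinearEquiv.ofFinrankEq (by simp [hd])
  refine ⟨fun x => ⟨φ (e x), hr _⟩, fun A => e.symm (ψ A), fun x => ?_, fun A hA x => ?_, ?_, ?_⟩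
  · exact mem_patCell.2 ⟨_, rfl, h1 _⟩
  · obtain ⟨A', g, hg, hA', hp, hG⟩ := hrep A hA
    have hψ : ψ (fun i j => A.1 i j) = ψ A'.1 := by
      rw [← h3 g A'.1 hg, ← hA']
    have key : toGr ⟨φ (ψ A'.1), hr _⟩ = toGr A := by
      obtain ⟨g', hg', h'⟩ := h4 A'.1 hp
      exact (hgr A' ⟨φ (ψ A'.1), hr _⟩ g' hg' h').trans hG
    change e.symm (ψ fun i j => A.1 i j) = x ↔ toGr ⟨φ (e x), hr _⟩ = toGr A
    rw [hψ]
    constructor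
    · rintro rfl
      simpa using key
    · intro h
      rw [← key] at h
      obtain ⟨g', hg'⟩ := toGr_eq_iff.1 h
      have h7 := h3 g' (φ (e x)) ((Matrix.isUnit_iff_isUnit_det _).1 g'.isUnit |>.ne_zero)
      rw [← hg', h2, h2] at h7
      rw [h7, e.symm_apply_apply]
  · exact h5.comp e.contDiff
  · intro A hA
    obtain ⟨A', g, hg, hA', hp, -⟩ := hrep A hA
    -- A representative `g * A'` with `det g < 0` has minors of the wrong sign, so smoothness may
    -- only rely on which minors are nonzero.
    refine e.symm.contDiff.contDiffAt.comp _ (h6 _ fun i j hij => ?_)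
    have : pl (fun i j => A.1 i j) i j = g.det * pl A'.1 i j := by
      rw [← pl_mul, ← hA']
    rw [this, ← (hp i j hij).2]
    simp [hg]

end Coordinates

/-! ## The cell of a shape and its coordinates -/

section Shape

variable {n : ℕ}

/-- The bases of a rank two positroid: `S` is the set of its nonzero columns, and `D` consists of the
first elements of its parallel classes, which are cyclic intervals of `S`. -/
def ShapeTest (S D : Finset (Fin n)) (i j : Fin n) : Prop :=
  i ∈ S ∧ j ∈ S ∧ (∃ d ∈ D, i < d ∧ d ≤ j) ∧ ∃ d ∈ D, d ≤ i ∨ j < d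

instance (S D : Finset (Fin n)) (i j : Fin n) : Decidable (ShapeTest S D i j) := by
  unfold ShapeTest; infer_instance

/-- `d0 < d1` are the smallest elements of `D ⊆ S`, and `prev` is the predecessor in `D`. -/
structure IsShape (S D : Finset (Fin n)) (d0 d1 : Fin n) (prev : Fin n → Fin n) : Prop where
  sub : D ⊆ S
  mem0 : d0 ∈ D
  mem1 : d1 ∈ D
  lt : d0 < d1
  cases : ∀ d ∈ D, d = d0 ∨ d1 ≤ d
  prev_mem : ∀ d ∈ D, d1 < d → prev d ∈ D
  prev_lt : ∀ d ∈ D, d1 < d → prev d < d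
  le_prev : ∀ d ∈ D, d1 < d → ∀ d' ∈ D, d' < d → d' ≤ prev d

theorem exists_isShape {S D : Finset (Fin n)} (hD : D ⊆ S) (h2 : 2 ≤ D.card) :
    ∃ d0 d1 prev, IsShape S D d0 d1 prev := by
  have hne : D.Nonempty := Finset.card_pos.1 (by omega)
  obtain ⟨d0, h0, h0'⟩ := D.exists_min_image id hne
  have hne' : (D.erase d0).Nonempty := by
    rw [← Finset.card_pos, Finset.card_erase_of_mem h0]; omega
  obtain ⟨d1, h1, h1'⟩ := (D.erase d0).exists_min_image id hne'
  have hp : ∀ d : Fin n, ∃ p, d1 < d → p ∈ D ∧ p < d ∧ ∀ d' ∈ D, d' < d → d' ≤ p := by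
    intro d
    by_cases hd : d1 < d
    · obtain ⟨p, hp, hp'⟩ := (D.filter (· < d)).exists_max_image id
        ⟨d1, by simpa [hd] using Finset.mem_of_mem_erase h1⟩
      rw [Finset.mem_filter] at hp
      exact ⟨p, fun _ => ⟨hp.1, hp.2, fun d' hd' hlt => hp' d' (by simp [hd', hlt])⟩⟩
    · exact ⟨d, fun h => absurd h hd⟩
  choose prev hprev using hp
  refine ⟨d0, d1, prev, hD, h0, Finset.mem_of_mem_erase h1,
    lt_of_le_of_ne (h0' d1 (Finset.mem_of_mem_erase h1)) (Finset.ne_of_mem_erase h1).symm,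
    fun d hd => ?_, fun d _ h => (hprev d h).1, fun d _ h => (hprev d h).2.1,
    fun d _ h => (hprev d h).2.2⟩
  by_cases h : d = d0
  · exact Or.inl h
  · exact Or.inr (h1' d (Finset.mem_erase.2 ⟨h, hd⟩))

/-- The index set of the coordinates: the scales of the columns in `S` and the positions of the
classes, except for the first two classes. -/
abbrev ShapeIndex (S D : Finset (Fin n)) (d0 d1 : Fin n) : Type :=
  {a // a ∈ (S.erase d0).erase d1} ⊕ {a // a ∈ (D.erase d0).erase d1}

variable {S D : Finset (Fin n)} {d0 d1 : Fin n} {prev : Fin n → Fin n}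

theorem IsShape.card (h : IsShape S D d0 d1 prev) :
    Fintype.card (ShapeIndex S D d0 d1) = S.card + D.card - 4 := by
  have key : ∀ T : Finset (Fin n), D ⊆ T → ((T.erase d0).erase d1).card + 2 = T.card := by
    intro T hT
    have h1 : d1 ∈ T.erase d0 := Finset.mem_erase.2 ⟨h.lt.ne', hT h.mem1⟩
    have := Finset.card_erase_add_one h1
    have := Finset.card_erase_add_one (hT h.mem0)
    omega
  have := key S h.sub
  have := key D subset_rfl
  simp only [Fintype.card_sum, Fintype.card_coe]
  omega

variable (S D d0 d1)

/-- The logarithmic scale of a column. -/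
def logScale (x : ShapeIndex S D d0 d1 → ℝ) (a : Fin n) : ℝ :=
  if h : a ∈ (S.erase d0).erase d1 then x (Sum.inl ⟨a, h⟩) else 0

/-- The logarithm of the distance between a class and the preceding class. -/
def logGap (x : ShapeIndex S D d0 d1 → ℝ) (a : Fin n) : ℝ :=
  if h : a ∈ (D.erase d0).erase d1 then x (Sum.inr ⟨a, h⟩) else 0

/-- The sum of the gaps `exp (w d)` over the class starts `d` with `p d`. -/
noncomputable def gapSum (w : Fin n → ℝ) (p : Fin n → Prop) [DecidablePred p] : ℝ :=
  ∑ d ∈ D with p d, Real.exp (w d)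

/-- The position of the column `a`. -/
noncomputable def slope (w : Fin n → ℝ) (a : Fin n) : ℝ :=
  gapSum D w fun d => d1 < d ∧ (d ≤ a ∨ a < d0)

/-- The columns of the matrix with given positions of the classes, up to scale. -/
noncomputable def direction (w : Fin n → ℝ) (b : Fin 2) (a : Fin n) : ℝ :=
  if d0 ≤ a ∧ a < d1 then if b = 0 then 1 else 0 else if b = 0 then -slope D d0 d1 w a else 1

/-- The columns before `d0` are reversed. -/
noncomputable def colSign (a : Fin n) : ℝ := if a < d0 then -1 else 1

/-- The matrix with given coordinates. -/
noncomputable def shapeMat (x : ShapeIndex S D d0 d1 → ℝ) (b : Fin 2) (a : Fin n) : ℝ :=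
  if a ∈ S then colSign d0 a * Real.exp (logScale S D d0 d1 x a) *
    direction D d0 d1 (logGap S D d0 d1 x) b a else 0

/-- The coordinates of a matrix. -/
noncomputable def shapeCoord (prev : Fin n → Fin n) (A : Fin 2 → Fin n → ℝ) :
    ShapeIndex S D d0 d1 → ℝ
  | Sum.inl a => Real.log ((if d0 ≤ a.1 ∧ a.1 < d1 then pl A a d1 else pl A d0 a) / pl A d0 d1)
  | Sum.inr a => Real.log (pl A d0 d1 * pl A (prev a) a / (pl A d0 a * pl A d0 (prev a)))

variable {S D d0 d1}

theorem gapSum_sub {w : Fin n → ℝ} {p q : Fin n → Prop} [DecidablePred p] [DecidablePred q]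
    (h : ∀ d ∈ D, q d → p d) : gapSum D w p - gapSum D w q = gapSum D w fun d => p d ∧ ¬q d := by
  rw [sub_eq_iff_eq_add, gapSum, gapSum, gapSum, ← Finset.sum_union]
  · refine Finset.sum_congr ?_ fun _ _ => rfl
    ext d
    simp only [Finset.mem_filter, Finset.mem_union]
    have := h d
    tauto
  · rw [Finset.disjoint_filter]
    tauto

theorem gapSum_nonneg (w : Fin n → ℝ) (p : Fin n → Prop) [DecidablePred p] : 0 ≤ gapSum D w p :=
  Finset.sum_nonneg fun _ _ => (Real.exp_pos _).le

theorem gapSum_ne_zero_iff (w : Fin n → ℝ) (p : Fin n → Prop) [DecidablePred p] :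
    gapSum D w p ≠ 0 ↔ ∃ d ∈ D, p d := by
  rw [Ne, gapSum, Finset.sum_eq_zero_iff_of_nonneg fun _ _ => (Real.exp_pos _).le]
  simp [Real.exp_ne_zero]

theorem gapSum_eq_zero {w : Fin n → ℝ} {p : Fin n → Prop} [DecidablePred p] (h : ∀ d ∈ D, ¬p d) :
    gapSum D w p = 0 := by
  by_contra h0
  obtain ⟨d, hd, hp⟩ := (gapSum_ne_zero_iff w p).1 h0
  exact h d hd hp

theorem gapSum_congr {w : Fin n → ℝ} {p q : Fin n → Prop} [DecidablePred p] [DecidablePred q]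
    (h : ∀ d ∈ D, p d ↔ q d) : gapSum D w p = gapSum D w q :=
  Finset.sum_congr (Finset.filter_congr h) fun _ _ => rfl

theorem pl_shapeMat (x : ShapeIndex S D d0 d1 → ℝ) {i j : Fin n} (hi : i ∈ S) (hj : j ∈ S) :
    pl (shapeMat S D d0 d1 x) i j =
      Real.exp (logScale S D d0 d1 x i) * Real.exp (logScale S D d0 d1 x j) *
        (colSign d0 i * colSign d0 j * pl (direction D d0 d1 (logGap S D d0 d1 x)) i j) := by
  simp only [pl, shapeMat, hi, hj, if_true]
  ring

/-- The columns in `[d0, d1)` point along the first axis; the others are `(-slope, 1)`, with slope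
growing by a positive gap at each later class start. Columns before `d0` belong to the last class,
wrapped around with the sign reversed. Every minor is thus 0, 1 or a sum of gaps, and it is nonzero
exactly if there are class starts both inside and outside the interval `(i, j]`. -/
theorem IsShape.direction_pattern (h : IsShape S D d0 d1 prev) (w : Fin n → ℝ) {i j : Fin n}
    (hij : i < j) : 0 ≤ colSign d0 i * colSign d0 j * pl (direction D d0 d1 w) i j ∧
      (colSign d0 i * colSign d0 j * pl (direction D d0 d1 w) i j ≠ 0 ↔
        (∃ d ∈ D, i < d ∧ d ≤ j) ∧ ∃ d ∈ D, d ≤ i ∨ j < d) := by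
  have hlt := h.lt
  have hm0 := h.mem0
  have hm1 := h.mem1
  have hge : ∀ d ∈ D, d0 ≤ d := fun d hd => (h.cases d hd).elim (fun h => h.ge) (hlt.le.trans)
  by_cases hi0 : i < d0
  · have hic : ¬(d0 ≤ i ∧ i < d1) := fun h => hi0.not_ge h.1
    by_cases hj0 : j < d0
    · have hjc : ¬(d0 ≤ j ∧ j < d1) := fun h => hj0.not_ge h.1
      have : slope D d0 d1 w i = slope D d0 d1 w j := gapSum_congr fun d _ => by simp [hi0, hj0]
      refine ⟨by simp [pl, direction, hic, hjc, this], ?_⟩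
      simp only [pl, direction, hic, hjc, this]
      simp only [if_false, if_true, Fin.isValue, one_ne_zero, mul_one, sub_self, mul_zero, ne_eq,
        not_true, false_iff]
      rintro ⟨⟨d, hd, -, hdj⟩, -⟩
      exact (hge d hd).not_gt (hdj.trans_lt hj0)
    · have hd0 : ∃ d ∈ D, i < d ∧ d ≤ j := ⟨d0, hm0, hi0, not_lt.1 hj0⟩
      by_cases hj1 : j < d1
      · have hjc : d0 ≤ j ∧ j < d1 := ⟨not_lt.1 hj0, hj1⟩
        have : colSign d0 i * colSign d0 j * pl (direction D d0 d1 w) i j = 1 := by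
          simp [pl, direction, hic, hjc, colSign, hi0, hj0]
        rw [this]
        exact ⟨zero_le_one, iff_of_true one_ne_zero ⟨hd0, d1, hm1, Or.inr hj1⟩⟩
      · have hjc : ¬(d0 ≤ j ∧ j < d1) := fun h => hj1 h.2
        have e : colSign d0 i * colSign d0 j * pl (direction D d0 d1 w) i j =
            slope D d0 d1 w i - slope D d0 d1 w j := by
          simp only [pl, direction, hic, hjc, colSign, hi0, hj0]
          simp
          ring
        rw [e, slope, slope, gapSum_sub (by simp_all)]
        refine ⟨gapSum_nonneg _ _, ?_⟩
        rw [gapSum_ne_zero_iff]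
        constructor
        · rintro ⟨d, hd, ⟨h2, -⟩, h3⟩
          exact ⟨hd0, d, hd, Or.inr (not_le.1 fun h4 => h3 ⟨h2, Or.inl h4⟩)⟩
        · rintro ⟨-, d, hd, h2 | h2⟩
          · exact absurd (h2.trans_lt hi0) (hge d hd).not_gt
          · exact ⟨d, hd, ⟨(not_lt.1 hj1).trans_lt h2, Or.inr hi0⟩,
              fun h3 => h3.2.elim h2.not_ge hj0⟩
  · have hj0 : ¬j < d0 := fun h => hi0 (hij.trans h)
    have hsgn : colSign d0 i * colSign d0 j = 1 := by simp [colSign, hi0, hj0]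
    have hd0 : ∃ d ∈ D, d ≤ i ∨ j < d := ⟨d0, hm0, Or.inl (not_lt.1 hi0)⟩
    rw [hsgn, one_mul]
    by_cases hi1 : i < d1
    · have hic : d0 ≤ i ∧ i < d1 := ⟨not_lt.1 hi0, hi1⟩
      by_cases hj1 : j < d1
      · have hjc : d0 ≤ j ∧ j < d1 := ⟨not_lt.1 hj0, hj1⟩
        have : pl (direction D d0 d1 w) i j = 0 := by simp [pl, direction, hic, hjc]
        rw [this]
        refine ⟨le_rfl, iff_of_false (by simp) ?_⟩
        rintro ⟨⟨d, hd, h2, h3⟩, -⟩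
        rcases h.cases d hd with rfl | h4
        · exact hi0 h2
        · exact (h4.trans h3).not_gt hj1
      · have hjc : ¬(d0 ≤ j ∧ j < d1) := fun h => hj1 h.2
        have : pl (direction D d0 d1 w) i j = 1 := by simp [pl, direction, hic, hjc]
        rw [this]
        exact ⟨zero_le_one, iff_of_true one_ne_zero ⟨⟨d1, hm1, hi1, not_lt.1 hj1⟩, hd0⟩⟩
    · have hj1 : ¬j < d1 := fun h => hi1 (hij.trans h)
      have hic : ¬(d0 ≤ i ∧ i < d1) := fun h => hi1 h.2
      have hjc : ¬(d0 ≤ j ∧ j < d1) := fun h => hj1 h.2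
      have e : pl (direction D d0 d1 w) i j = slope D d0 d1 w j - slope D d0 d1 w i := by
        simp only [pl, direction, hic, hjc]
        simp
        ring
      rw [e, slope, slope, gapSum_sub]
      · refine ⟨gapSum_nonneg _ _, ?_⟩
        rw [gapSum_ne_zero_iff]
        constructor
        · rintro ⟨d, hd, ⟨h2, h3⟩, h4⟩
          exact ⟨⟨d, hd, not_le.1 fun h5 => h4 ⟨h2, Or.inl h5⟩, h3.resolve_right hj0⟩, hd0⟩
        · rintro ⟨⟨d, hd, h2, h3⟩, -⟩
          exact ⟨d, hd, ⟨(not_lt.1 hi1).trans_lt h2, Or.inl h3⟩,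
            fun h4 => h4.2.elim h2.not_ge hi0⟩
      · rintro d - ⟨h2, h3⟩
        exact ⟨h2, h3.elim (fun h3 => Or.inl (h3.trans hij.le)) fun h3 => absurd h3 hi0⟩

theorem IsShape.hasPattern (h : IsShape S D d0 d1 prev) (x : ShapeIndex S D d0 d1 → ℝ) :
    HasPattern (ShapeTest S D) (shapeMat S D d0 d1 x) := by
  intro i j hij
  by_cases hi : i ∈ S
  · by_cases hj : j ∈ S
    · obtain ⟨h1, h2⟩ := h.direction_pattern (logGap S D d0 d1 x) hij
      have h3 := pl_shapeMat x hi hj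
      constructor
      · exact (mul_nonneg (by positivity) h1).trans_eq h3.symm
      · refine (not_congr (by rw [h3])).trans (Iff.trans ?_ h2 |>.trans ?_)
        · simp
        · simp only [ShapeTest, hi, hj, true_and]
    · have : pl (shapeMat S D d0 d1 x) i j = 0 := by simp [pl, shapeMat, hj]
      exact ⟨this.ge, iff_of_false (not_not.2 this) fun h => hj h.2.1⟩
  · have : pl (shapeMat S D d0 d1 x) i j = 0 := by simp [pl, shapeMat, hi]
    exact ⟨this.ge, iff_of_false (not_not.2 this) fun h => hi h.1⟩

end Shape

/-! ### The coordinates invert the parametrization -/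

section Shape

variable {n : ℕ} {S D : Finset (Fin n)} {d0 d1 : Fin n} {prev : Fin n → Fin n}

theorem pl_swap {R ι : Type*} [CommRing R] (A : Fin 2 → ι → R) (i j : ι) : pl A i j = -pl A j i := by
  simp only [pl]; ring

theorem pl_self {R ι : Type*} [CommRing R] (A : Fin 2 → ι → R) (i : ι) : pl A i i = 0 := by
  simp only [pl]; ring

theorem contDiff_pl (i j : Fin n) : ContDiff ℝ ∞ fun A : Fin 2 → Fin n → ℝ => pl A i j := by
  unfold pl
  fun_prop

/-- Each coordinate is the logarithm of a quotient of equally many minors, so the determinant of `g`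
cancels. -/
theorem shapeCoord_mul (g : Matrix (Fin 2) (Fin 2) ℝ) (A : Matrix (Fin 2) (Fin n) ℝ)
    (hg : g.det ≠ 0) : shapeCoord S D d0 d1 prev (g * A : Matrix (Fin 2) (Fin n) ℝ) =
      shapeCoord S D d0 d1 prev A := by
  funext x
  rcases x with a | a
  · simp only [shapeCoord, pl_mul]
    congr 1
    split_ifs <;> exact mul_div_mul_left _ _ hg
  · simp only [shapeCoord, pl_mul]
    congr 1
    rw [show g.det * pl A d0 d1 * (g.det * pl A (prev a) a) =
      (g.det * g.det) * (pl A d0 d1 * pl A (prev a) a) by ring,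
      show g.det * pl A d0 a * (g.det * pl A d0 (prev a)) =
      (g.det * g.det) * (pl A d0 a * pl A d0 (prev a)) by ring,
      mul_div_mul_left _ _ (mul_ne_zero hg hg)]

theorem mem_erase_erase {T : Finset (Fin n)} {a : Fin n} :
    a ∈ (T.erase d0).erase d1 ↔ a ∈ T ∧ a ≠ d0 ∧ a ≠ d1 := by
  simp only [Finset.mem_erase]; tauto

theorem IsShape.gap_lt (h : IsShape S D d0 d1 prev) {d : Fin n}
    (hd : d ∈ (D.erase d0).erase d1) : d ∈ D ∧ d1 < d := by
  obtain ⟨h1, h2, h3⟩ := mem_erase_erase.1 hd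
  exact ⟨h1, lt_of_le_of_ne ((h.cases d h1).resolve_left h2) h3.symm⟩

theorem IsShape.le_prev_one (h : IsShape S D d0 d1 prev) {d : Fin n} (hd : d ∈ D) (h1 : d1 < d) :
    d1 ≤ prev d := h.le_prev d hd h1 d1 h.mem1 h1

/-- The columns whose scale is a coordinate are not proportional to the column used as reference. -/
theorem IsShape.scale_ne_zero (h : IsShape S D d0 d1 prev) {A : Fin 2 → Fin n → ℝ}
    (hA : ∀ i j, i < j → (pl A i j ≠ 0 ↔ ShapeTest S D i j)) {a : Fin n} (ha : a ∈ S) :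
    (if d0 ≤ a ∧ a < d1 then pl A a d1 else pl A d0 a) ≠ 0 := by
  have hlt := h.lt
  split_ifs with hc
  · exact (hA _ _ hc.2).2 ⟨ha, h.sub h.mem1, ⟨d1, h.mem1, hc.2, le_rfl⟩, d0, h.mem0, Or.inl hc.1⟩
  · rcases lt_or_ge a d0 with h0 | h0
    · rw [pl_swap, neg_ne_zero]
      exact (hA _ _ h0).2 ⟨ha, h.sub h.mem0, ⟨d0, h.mem0, h0, le_rfl⟩, d1, h.mem1, Or.inr hlt⟩
    · have h1 : d1 ≤ a := not_lt.1 fun h1 => hc ⟨h0, h1⟩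
      exact (hA _ _ (hlt.trans_le h1)).2 ⟨h.sub h.mem0, ha, ⟨d1, h.mem1, hlt, h1⟩, d0, h.mem0,
        Or.inl le_rfl⟩

theorem IsShape.pl_start_ne_zero (h : IsShape S D d0 d1 prev) {A : Fin 2 → Fin n → ℝ}
    (hA : ∀ i j, i < j → (pl A i j ≠ 0 ↔ ShapeTest S D i j)) {d d' : Fin n} (hd : d ∈ D)
    (hd' : d' ∈ D) (hlt : d < d') : pl A d d' ≠ 0 :=
  (hA _ _ hlt).2 ⟨h.sub hd, h.sub hd', ⟨d', hd', hlt, le_rfl⟩, d, hd, Or.inl le_rfl⟩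

theorem IsShape.contDiffAt (h : IsShape S D d0 d1 prev) {A : Fin 2 → Fin n → ℝ}
    (hA : ∀ i j, i < j → (pl A i j ≠ 0 ↔ ShapeTest S D i j)) :
    ContDiffAt ℝ ∞ (shapeCoord S D d0 d1 prev) A := by
  have hlt := h.lt
  have h01 : pl A d0 d1 ≠ 0 := h.pl_start_ne_zero hA h.mem0 h.mem1 hlt
  rw [contDiffAt_pi]
  rintro (a | a)
  · have h1 := h.scale_ne_zero hA (mem_erase_erase.1 a.2).1
    refine ContDiffAt.log (ContDiffAt.div ?_ (contDiff_pl _ _).contDiffAt h01) (div_ne_zero h1 h01)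
    split_ifs
    · exact (contDiff_pl _ _).contDiffAt
    · exact (contDiff_pl _ _).contDiffAt
  · obtain ⟨ha, ha1⟩ := h.gap_lt a.2
    have hp := h.prev_mem a ha ha1
    have hp1 := h.le_prev_one ha ha1
    have h1 : pl A d0 a * pl A d0 (prev a) ≠ 0 := mul_ne_zero
      (h.pl_start_ne_zero hA h.mem0 ha (hlt.trans ha1))
      (h.pl_start_ne_zero hA h.mem0 hp (hlt.trans_le hp1))
    refine ContDiffAt.log (ContDiffAt.div
      ((contDiff_pl _ _).contDiffAt.mul (contDiff_pl _ _).contDiffAt)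
      ((contDiff_pl _ _).contDiffAt.mul (contDiff_pl _ _).contDiffAt) h1)
      (div_ne_zero (mul_ne_zero h01 ?_) h1)
    exact h.pl_start_ne_zero hA hp ha (h.prev_lt a ha ha1)

theorem contDiff_shapeMat : ContDiff ℝ ∞ (shapeMat S D d0 d1) := by
  have h1 : ∀ a, ContDiff ℝ ∞ fun x => logScale S D d0 d1 x a := by
    intro a
    unfold logScale
    split_ifs <;> fun_prop
  have h2 : ∀ a, ContDiff ℝ ∞ fun x => logGap S D d0 d1 x a := by
    intro a
    unfold logGap
    split_ifs <;> fun_prop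
  have h3 : ∀ a, ContDiff ℝ ∞ fun x => slope D d0 d1 (logGap S D d0 d1 x) a := fun a =>
    ContDiff.sum fun d _ => (h2 d).exp
  rw [contDiff_pi]
  intro b
  rw [contDiff_pi]
  intro a
  unfold shapeMat
  split_ifs
  · refine (contDiff_const.mul (h1 a).exp).mul ?_
    unfold direction
    split_ifs
    · exact contDiff_const
    · exact contDiff_const
    · exact (h3 a).neg
    · exact contDiff_const
  · exact contDiff_const

/-- Between `prev d` and `d` there is no class start other than `d`, so the two sums differ by one
term. -/
theorem IsShape.slope_gap (h : IsShape S D d0 d1 prev) (w : Fin n → ℝ) {d : Fin n} (hd : d ∈ D)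
    (h1 : d1 < d) : slope D d0 d1 w d = slope D d0 d1 w (prev d) + Real.exp (w d) := by
  have hlt := h.lt
  have hp := h.prev_lt d hd h1
  have hp1 := h.le_prev_one hd h1
  rw [← sub_eq_iff_eq_add', slope, slope, gapSum_sub]
  · rw [gapSum, Finset.sum_eq_single_of_mem d]
    · rw [Finset.mem_filter]
      exact ⟨hd, ⟨h1, Or.inl le_rfl⟩, fun h2 => h2.2.elim hp.not_ge
        fun h3 => (hlt.trans_le hp1).not_gt h3⟩
    · intro d' hd' hne
      rw [Finset.mem_filter] at hd'
      obtain ⟨hd', ⟨h2, h3⟩, h4⟩ := hd'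
      have h5 : d' ≤ d := h3.resolve_right (hlt.trans h1).not_gt
      exact absurd ⟨h2, Or.inl (h.le_prev d hd h1 d' hd' (lt_of_le_of_ne h5 hne))⟩ h4
  · rintro d' - ⟨h2, h3⟩
    exact ⟨h2, Or.inl ((h3.resolve_right (hlt.trans_le hp1).not_gt).trans hp.le)⟩

theorem slope_one (w : Fin n → ℝ) (hlt : d0 < d1) : slope D d0 d1 w d1 = 0 :=
  gapSum_eq_zero fun _ _ h => h.2.elim h.1.not_ge hlt.not_gt

theorem IsShape.shapeCoord_shapeMat (h : IsShape S D d0 d1 prev) (x : ShapeIndex S D d0 d1 → ℝ) :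
    shapeCoord S D d0 d1 prev (shapeMat S D d0 d1 x) = x := by
  have hlt := h.lt
  have c0 : d0 ≤ d0 ∧ d0 < d1 := ⟨le_rfl, hlt⟩
  have c1 : ∀ {a}, d1 ≤ a → ¬(d0 ≤ a ∧ a < d1) := fun h1 h2 => h1.not_gt h2.2
  have s1 : ∀ {a}, d0 ≤ a → colSign d0 a = 1 := fun h => if_neg h.not_gt
  have l0 : logScale S D d0 d1 x d0 = 0 := dif_neg (by simp)
  have l1 : logScale S D d0 d1 x d1 = 0 := dif_neg (by simp)
  have hS0 := h.sub h.mem0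
  have hS1 := h.sub h.mem1
  have h01 : pl (shapeMat S D d0 d1 x) d0 d1 = 1 := by
    rw [pl_shapeMat x hS0 hS1, l0, l1, s1 le_rfl, s1 hlt.le]
    simp [pl, direction, c0]
  funext y
  rcases y with ⟨a, ha⟩ | ⟨a, ha⟩
  · have haS := (mem_erase_erase.1 ha).1
    have hl : logScale S D d0 d1 x a = x (Sum.inl ⟨a, ha⟩) := dif_pos ha
    simp only [shapeCoord, h01, div_one]
    split_ifs with hc
    · rw [pl_shapeMat x haS hS1, l1, s1 hc.1, s1 hlt.le, hl]
      simp [pl, direction, hc]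
    · rw [pl_shapeMat x hS0 haS, l0, s1 le_rfl, hl]
      have : pl (direction D d0 d1 (logGap S D d0 d1 x)) d0 a = 1 := by
        simp [pl, direction, hc, hlt]
      rw [this]
      unfold colSign
      split_ifs <;> simp
  · obtain ⟨haD, ha1⟩ := h.gap_lt ha
    have hp := h.prev_mem a haD ha1
    have hp1 := h.le_prev_one haD ha1
    have hl : logGap S D d0 d1 x a = x (Sum.inr ⟨a, ha⟩) := dif_pos ha
    simp only [shapeCoord, h01, one_mul]
    rw [pl_shapeMat x (h.sub hp) (h.sub haD), pl_shapeMat x hS0 (h.sub haD),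
      pl_shapeMat x hS0 (h.sub hp), l0, s1 le_rfl, s1 (hlt.le.trans hp1),
      s1 (hlt.le.trans ha1.le)]
    have e1 : ∀ {a}, d1 ≤ a → pl (direction D d0 d1 (logGap S D d0 d1 x)) d0 a = 1 := by
      intro a h1
      simp [pl, direction, hlt, c1 h1]
    have e2 : pl (direction D d0 d1 (logGap S D d0 d1 x)) (prev a) a =
        Real.exp (x (Sum.inr ⟨a, ha⟩)) := by
      simp [pl, direction, c1 hp1, c1 ha1.le, h.slope_gap _ haD ha1, hl]
    rw [e1 hp1, e1 ha1.le, e2]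
    simp only [Real.exp_zero, one_mul, mul_one]
    rw [mul_comm (Real.exp _) (Real.exp (logScale S D d0 d1 x a)),
      mul_div_cancel_left₀ _ (by positivity), Real.log_exp]

/-- The position of a column, computed from the minors. -/
noncomputable def ratio (d0 d1 : Fin n) (A : Fin 2 → Fin n → ℝ) (a : Fin n) : ℝ :=
  pl A d1 a / pl A d0 a

theorem ratio_eq_of_pl_eq_zero {A : Fin 2 → Fin n → ℝ} {a b : Fin n} (ha : pl A d0 a ≠ 0)
    (hb : pl A d0 b ≠ 0) (h : pl A a b = 0) : ratio d0 d1 A a = ratio d0 d1 A b := by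
  rw [ratio, ratio, div_eq_div_iff ha hb]
  have : pl A d1 a * pl A d0 b - pl A d1 b * pl A d0 a = -(pl A d0 d1 * pl A a b) := by
    simp only [pl]; ring
  rw [h, mul_zero, neg_zero] at this
  linarith

/-- By the Plücker relation, the coordinate at a class start is the logarithm of the difference of
the ratios at that start and the preceding one. The sum telescopes from `d1`, where both sides are
zero; a general column is parallel to the last class start before it. -/
theorem IsShape.slope_eq_ratio (h : IsShape S D d0 d1 prev) {A : Fin 2 → Fin n → ℝ}
    (hA : HasPattern (ShapeTest S D) A) {a : Fin n} (ha : a ∈ S) (h1 : d1 ≤ a) :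
    slope D d0 d1 (logGap S D d0 d1 (shapeCoord S D d0 d1 prev A)) a = ratio d0 d1 A a := by
  have hlt := h.lt
  set w := logGap S D d0 d1 (shapeCoord S D d0 d1 prev A) with hw
  have hA' : ∀ i j, i < j → (pl A i j ≠ 0 ↔ ShapeTest S D i j) := fun i j hij => (hA i j hij).2
  have hpos : ∀ {d d'}, d ∈ D → d' ∈ D → d < d' → 0 < pl A d d' := fun hd hd' hlt =>
    lt_of_le_of_ne (hA _ _ hlt).1 (h.pl_start_ne_zero hA' hd hd' hlt).symm
  have h0 : ∀ {a}, a ∈ S → d1 ≤ a → pl A d0 a ≠ 0 := by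
    intro a ha h1
    have := h.scale_ne_zero hA' ha
    rwa [if_neg fun h2 => h1.not_gt h2.2] at this
  have hD : ∀ d, d ∈ D → d1 ≤ d → slope D d0 d1 w d = ratio d0 d1 A d := by
    intro d
    induction d using WellFoundedLT.induction with
    | _ d ih =>
    intro hd hd1
    rcases hd1.eq_or_lt with rfl | hd1
    · rw [slope_one w hlt, ratio, pl_self, zero_div]
    · have hp := h.prev_mem d hd hd1
      have hp1 := h.le_prev_one hd hd1
      have hpl := h.prev_lt d hd hd1
      rw [h.slope_gap w hd hd1, ih _ hpl hp hp1]
      have hm : d ∈ (D.erase d0).erase d1 :=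
        mem_erase_erase.2 ⟨hd, (hlt.trans hd1).ne', hd1.ne'⟩
      have ew : w d = Real.log (pl A d0 d1 * pl A (prev d) d / (pl A d0 d * pl A d0 (prev d))) := by
        rw [hw, logGap, dif_pos hm]; rfl
      have p1 := hpos h.mem0 h.mem1 hlt
      have p2 := hpos hp hd hpl
      have p3 := hpos h.mem0 hd (hlt.trans hd1)
      have p4 := hpos h.mem0 hp (hlt.trans_le hp1)
      rw [ew, Real.exp_log (by positivity), ratio, ratio]
      field_simp
      simp only [pl]
      ring
  obtain ⟨m, hm, hmax⟩ := (D.filter (· ≤ a)).exists_max_image id ⟨d1, by simp [h.mem1, h1]⟩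
  rw [Finset.mem_filter] at hm
  have hm1 : d1 ≤ m := hmax d1 (by simp [h.mem1, h1])
  have hs : slope D d0 d1 w a = slope D d0 d1 w m := by
    refine gapSum_congr fun d hd => and_congr_right fun h2 => ?_
    simp only [(hlt.trans_le h1).not_gt, (hlt.trans_le hm1).not_gt, or_false]
    exact ⟨fun h3 => hmax d (by simp [hd, h3]), fun h3 => h3.trans hm.2⟩
  rw [hs, hD m hm.1 hm1]
  rcases hm.2.eq_or_lt with rfl | hma
  · rfl
  · refine ratio_eq_of_pl_eq_zero (h0 (h.sub hm.1) hm1) (h0 ha h1) ?_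
    by_contra hne
    obtain ⟨-, -, ⟨d, hd, h2, h3⟩, -⟩ := (hA' _ _ hma).1 hne
    exact (hmax d (by simp [hd, h3])).not_gt h2

/-- A column before `d0` is parallel to the largest class start, since its class wraps around; its
slope counts every gap. -/
theorem IsShape.slope_eq_ratio_of_lt (h : IsShape S D d0 d1 prev) {A : Fin 2 → Fin n → ℝ}
    (hA : HasPattern (ShapeTest S D) A) {a : Fin n} (ha : a ∈ S) (h1 : a < d0) :
    slope D d0 d1 (logGap S D d0 d1 (shapeCoord S D d0 d1 prev A)) a = ratio d0 d1 A a := by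
  have hlt := h.lt
  have hA' : ∀ i j, i < j → (pl A i j ≠ 0 ↔ ShapeTest S D i j) := fun i j hij => (hA i j hij).2
  obtain ⟨m, hm, hmax⟩ := D.exists_max_image id ⟨d1, h.mem1⟩
  have hm1 : d1 ≤ m := hmax d1 h.mem1
  have hs : slope D d0 d1 (logGap S D d0 d1 (shapeCoord S D d0 d1 prev A)) a =
      slope D d0 d1 (logGap S D d0 d1 (shapeCoord S D d0 d1 prev A)) m := by
    refine gapSum_congr fun d hd => and_congr_right fun h2 => ?_
    exact iff_of_true (Or.inr h1) (Or.inl (hmax d hd))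
  rw [hs, h.slope_eq_ratio hA (h.sub hm) hm1]
  have hne : ∀ {b}, b ∈ S → ¬(d0 ≤ b ∧ b < d1) → pl A d0 b ≠ 0 := by
    intro b hb hc
    have := h.scale_ne_zero hA' hb
    rwa [if_neg hc] at this
  refine (ratio_eq_of_pl_eq_zero (hne ha fun h2 => h2.1.not_gt h1)
    (hne (h.sub hm) fun h2 => h2.2.not_ge hm1) ?_).symm
  by_contra h0
  obtain ⟨-, -, -, d, hd, h2 | h2⟩ := (hA' a m (h1.trans (hlt.trans_le hm1))).1 h0
  · have : d0 ≤ d := (h.cases d hd).elim (fun h => h.ge) hlt.le.trans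
    exact this.not_gt (h2.trans_lt h1)
  · exact (hmax d hd).not_gt h2

theorem IsShape.exists_eq_mul (h : IsShape S D d0 d1 prev) (A : Fin 2 → Fin n → ℝ)
    (hA : HasPattern (ShapeTest S D) A) :
    ∃ g : Matrix (Fin 2) (Fin 2) ℝ, g.det ≠ 0 ∧
      Matrix.of A = g * Matrix.of (shapeMat S D d0 d1 (shapeCoord S D d0 d1 prev A)) := by
  have hlt := h.lt
  have hA' : ∀ i j, i < j → (pl A i j ≠ 0 ↔ ShapeTest S D i j) := fun i j hij => (hA i j hij).2
  set x := shapeCoord S D d0 d1 prev A with hx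
  have h01 : 0 < pl A d0 d1 :=
    lt_of_le_of_ne (hA _ _ hlt).1 (h.pl_start_ne_zero hA' h.mem0 h.mem1 hlt).symm
  -- By Cramer's rule, the normal form must consist of the coordinates of the columns with respect
  -- to the basis `A_{d0}`, `A_{d1}`; the change of basis `g` used below has these columns.
  have key : ∀ a, shapeMat S D d0 d1 x 0 a = pl A a d1 / pl A d0 d1 ∧
      shapeMat S D d0 d1 x 1 a = pl A d0 a / pl A d0 d1 := by
    intro a
    by_cases ha : a ∈ S
    swap
    · have hz : ∀ b, pl A a b = 0 := by
        intro b
        by_contra hne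
        rcases lt_trichotomy a b with h1 | rfl | h1
        · exact ha ((hA' _ _ h1).1 hne).1
        · exact hne (pl_self _ _)
        · exact ha ((hA' _ _ h1).1 fun h2 => hne (by rw [pl_swap, h2, neg_zero])).2.1
      rw [pl_swap A d0 a]
      simp [shapeMat, ha, hz]
    -- `Real.log` sees only absolute values. The quotient is negative for columns before `d0`, and
    -- `colSign` restores that sign.
    have hl : Real.exp (logScale S D d0 d1 x a) =
        |(if d0 ≤ a ∧ a < d1 then pl A a d1 else pl A d0 a) / pl A d0 d1| := by
      unfold logScale
      split_ifs with hm hc hc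
      · rw [hx, shapeCoord, if_pos hc, Real.exp_log_eq_abs]
        have := h.scale_ne_zero hA' ha
        rw [if_pos hc] at this
        exact div_ne_zero this h01.ne'
      · rw [hx, shapeCoord, if_neg hc, Real.exp_log_eq_abs]
        have := h.scale_ne_zero hA' ha
        rw [if_neg hc] at this
        exact div_ne_zero this h01.ne'
      · have : a = d0 := by
          by_contra h1
          exact hm (mem_erase_erase.2 ⟨ha, h1, hc.2.ne⟩)
        rw [this, div_self h01.ne', Real.exp_zero, abs_one]
      · have : a = d1 := by
          by_contra h1
          refine hm (mem_erase_erase.2 ⟨ha, fun h2 => hc ⟨h2.ge, h2 ▸ hlt⟩, h1⟩)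
        rw [this, div_self h01.ne', Real.exp_zero, abs_one]
    by_cases hc : d0 ≤ a ∧ a < d1
    · have h1 : 0 ≤ pl A a d1 := (hA _ _ hc.2).1
      have h2 : pl A d0 a = 0 := by
        rcases hc.1.eq_or_lt with rfl | h3
        · exact pl_self _ _
        · by_contra hne
          obtain ⟨-, -, ⟨d, hd, h4, h5⟩, -⟩ := (hA' _ _ h3).1 hne
          rcases h.cases d hd with rfl | h6
          · exact lt_irrefl _ h4
          · exact (h6.trans h5).not_gt hc.2
      rw [if_pos hc, abs_of_nonneg (by positivity)] at hl
      simp [shapeMat, ha, colSign, hc.1.not_gt, direction, hc, hl, h2]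
    · rw [if_neg hc] at hl
      have hne := h.scale_ne_zero hA' ha
      rw [if_neg hc] at hne
      have hs : colSign d0 a * Real.exp (logScale S D d0 d1 x a) = pl A d0 a / pl A d0 d1 := by
        rw [hl]
        unfold colSign
        split_ifs with h1
        · have h2 : 0 ≤ pl A a d0 := (hA _ _ h1).1
          rw [pl_swap A d0 a, neg_div, abs_neg, abs_of_nonneg (by positivity)]
          ring
        · have h3 : d0 < a := not_le.1 fun h3 => hc ⟨(le_antisymm h3 (not_lt.1 h1)).ge,
            h3.trans_lt hlt⟩
          have h2 : 0 ≤ pl A d0 a := (hA _ _ h3).1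
          rw [one_mul, abs_of_nonneg (by positivity)]
      have ht : slope D d0 d1 (logGap S D d0 d1 x) a = ratio d0 d1 A a := by
        rcases lt_or_ge a d0 with h1 | h1
        · exact h.slope_eq_ratio_of_lt hA ha h1
        · exact h.slope_eq_ratio hA ha (not_lt.1 fun h2 => hc ⟨h1, h2⟩)
      constructor
      · simp only [shapeMat, ha, if_true, hs, direction, hc, if_false, ht, ratio]
        rw [pl_swap A a d1]
        field_simp
      · simp only [shapeMat, ha, if_true, hs, direction, hc, if_false]
        simp
  refine ⟨!![A 0 d0, A 0 d1; A 1 d0, A 1 d1], ?_, ?_⟩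
  · rw [Matrix.det_fin_two_of]
    exact h01.ne'
  · ext b a
    rw [Matrix.mul_apply, Fin.sum_univ_two]
    simp only [Matrix.of_apply, (key a).1, (key a).2]
    have := h01.ne'
    fin_cases b
    · simp
      field_simp
      simp only [pl]
      ring
    · simp
      field_simp
      simp only [pl]
      ring

/-- The cell of a shape is an open ball, of dimension `|S| + |D| - 4`. -/
theorem hasDimension_shape (hD : D ⊆ S) (h2 : 2 ≤ D.card) :
    HasDimension (patCell (ShapeTest S D)) (S.card + D.card - 4) := by
  obtain ⟨d0, d1, prev, h⟩ := exists_isShape hD h2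
  refine hasDimension_of_coordinates ⟨d0, d1, h.lt, ?_⟩ (shapeMat S D d0 d1)
    (shapeCoord S D d0 d1 prev) h.hasPattern h.shapeCoord_shapeMat
    (fun g A hg => shapeCoord_mul g A hg) h.exists_eq_mul contDiff_shapeMat
    (fun A hA => h.contDiffAt hA) h.card.symm
  exact ⟨h.sub h.mem0, h.sub h.mem1, ⟨d1, h.mem1, h.lt, le_rfl⟩, d0, h.mem0, Or.inl le_rfl⟩

theorem patCell_shape_nonempty (hD : D ⊆ S) (h2 : 2 ≤ D.card) :
    (patCell (ShapeTest S D)).Nonempty := by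
  obtain ⟨φ, -, h, -⟩ := hasDimension_shape hD h2
  exact ⟨_, h 0⟩

end Shape

/-! ## The shape of a totally nonnegative matrix -/

section Shape

variable {n : ℕ}

theorem pl_plucker {R ι : Type*} [CommRing R] (A : Fin 2 → ι → R) (i j k l : ι) :
    pl A i k * pl A j l = pl A i j * pl A k l + pl A i l * pl A j k := by
  simp only [pl]; ring

/-- Being parallel is transitive only through a nonzero column, hence the condition on `b`. -/
theorem pl_trans {A : Fin 2 → Fin n → ℝ} {a b c : Fin n} (hb : ∃ e, pl A b e ≠ 0)
    (h1 : pl A a b = 0) (h2 : pl A b c = 0) : pl A a c = 0 := by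
  obtain ⟨e, he⟩ := hb
  have h := pl_plucker A a b c e
  rw [h1, h2, zero_mul, mul_zero, add_zero] at h
  exact (mul_eq_zero.1 h).resolve_right he

/-- A totally nonnegative matrix of rank two has the pattern of a shape. -/
theorem exists_shape {A : Fin 2 → Fin n → ℝ} (hA : ∀ i j, i < j → 0 ≤ pl A i j)
    (hr : ∃ i j, pl A i j ≠ 0) : ∃ S D : Finset (Fin n), D ⊆ S ∧ 2 ≤ D.card ∧
      HasPattern (ShapeTest S D) A := by
  classical
  have hsymm : ∀ {a b}, pl A a b = 0 → pl A b a = 0 := fun {a b} h => by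
    rw [pl_swap, h, neg_zero]
  set S : Finset (Fin n) := Finset.univ.filter fun a => ∃ e, pl A a e ≠ 0 with hS
  have memS : ∀ {a}, a ∈ S ↔ ∃ e, pl A a e ≠ 0 := fun {a} => by simp [hS]
  have memS' : ∀ {a b}, pl A a b ≠ 0 → b ∈ S := fun {a b} h =>
    memS.2 ⟨a, fun h' => h (hsymm h')⟩
  have htrans : ∀ {a b c}, b ∈ S → pl A a b = 0 → pl A b c = 0 → pl A a c = 0 :=
    fun hb => pl_trans (memS.1 hb)
  -- `M` is the last nonzero column and `d0`, chosen next, the first nonzero column not parallel to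
  -- it. The nonzero columns before `d0` are the part of the class of `M` that wraps around.
  obtain ⟨M, hM, hmax⟩ : ∃ M ∈ S, ∀ a ∈ S, a ≤ M := by
    obtain ⟨i, j, hij⟩ := hr
    exact S.exists_max_image id ⟨i, memS.2 ⟨j, hij⟩⟩
  obtain ⟨d0, hd0, hmin⟩ : ∃ d0 ∈ S.filter (fun a => pl A a M ≠ 0),
      ∀ a ∈ S.filter (fun a => pl A a M ≠ 0), d0 ≤ a := by
    obtain ⟨e, he⟩ := memS.1 hM
    exact Finset.exists_min_image _ id ⟨e, by
      rw [Finset.mem_filter]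
      exact ⟨memS' he, fun h => he (hsymm h)⟩⟩
  rw [Finset.mem_filter] at hd0
  obtain ⟨hd0S, hd0M⟩ := hd0
  have hd0lt : d0 < M := lt_of_le_of_ne (hmax d0 hd0S) fun h => hd0M (by rw [h, pl_self])
  have hbefore : ∀ {a}, a ∈ S → a < d0 → pl A a M = 0 := by
    intro a ha hlt
    by_contra h
    exact (hmin a (by simp [ha, h])).not_gt hlt
  have hpos : ∀ {a b}, a < b → pl A a b ≠ 0 → 0 < pl A a b := fun hlt h =>
    lt_of_le_of_ne (hA _ _ hlt) h.symm
  -- From `d0` on, classes are intervals. If `a` and `c` are parallel but `b` between them is not,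
  -- the Plücker relation for `a, b, c, M` with nonnegative terms makes `a` parallel to `M`. The
  -- relation for `d0, a, b, M` then equates zero with a sum that has a positive term.
  have hint : ∀ {a b c}, c ∈ S → d0 ≤ a → a < b → b < c → pl A a c = 0 → pl A a b = 0 := by
    intro a b c hc h0a hab hbc hac
    by_contra hne
    have hne' := hpos hab hne
    have haM : pl A a M = 0 := by
      rcases (hmax c hc).eq_or_lt with rfl | hcM
      · exact hac
      · have h := pl_plucker A a b c M
        rw [hac, zero_mul] at h
        have h1 := mul_nonneg (hA _ _ (hab.trans (hbc.trans hcM))) (hA _ _ hbc)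
        have h2 := mul_nonneg hne'.le (hA _ _ hcM)
        have h3 : pl A a b * pl A c M = 0 := by linarith
        exact htrans hc hac ((mul_eq_zero.1 h3).resolve_left hne)
    have h0a' : d0 < a := lt_of_le_of_ne h0a fun h => hd0M (h ▸ haM)
    have hbM : b < M := hbc.trans_le (hmax c hc)
    have h := pl_plucker A d0 a b M
    rw [haM, mul_zero] at h
    have h1 := mul_nonneg (hA _ _ h0a') (hA _ _ hbM)
    have h2 := mul_pos (hpos hd0lt hd0M) hne'
    linarith
  set D : Finset (Fin n) := S.filter fun a => d0 ≤ a ∧ ∀ b ∈ S, d0 ≤ b → b < a → pl A b a ≠ 0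
    with hD
  have hd0D : d0 ∈ D := by
    rw [hD, Finset.mem_filter]
    exact ⟨hd0S, le_rfl, fun b _ h1 h2 => absurd h2 h1.not_gt⟩
  have hfirst : ∀ {i j}, i ∈ S → j ∈ S → d0 ≤ i → i < j →
      (pl A i j ≠ 0 ↔ ∃ d ∈ D, i < d ∧ d ≤ j) := by
    intro i j hi hj h0i hij
    constructor
    · intro hne
      obtain ⟨d, hd, hdmin⟩ := (S.filter fun a => d0 ≤ a ∧ a ≤ j ∧ pl A a j = 0).exists_min_image id
        ⟨j, by simp [hj, h0i.trans hij.le, pl_self]⟩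
      rw [Finset.mem_filter] at hd
      obtain ⟨hdS, h0d, hdj, hdz⟩ := hd
      refine ⟨d, ?_, ?_, hdj⟩
      · rw [hD, Finset.mem_filter]
        refine ⟨hdS, h0d, fun b hb h0b hbd hz => ?_⟩
        refine (hdmin b ?_).not_gt hbd
        rw [Finset.mem_filter]
        exact ⟨hb, h0b, hbd.le.trans hdj, htrans hdS hz hdz⟩
      · by_contra hdi
        rcases (not_lt.1 hdi).eq_or_lt with rfl | hdi
        · exact hne hdz
        · exact hne (htrans hdS (hsymm (hint hj h0d hdi hij hdz)) hdz)
    · rintro ⟨d, hd, hid, hdj⟩ hz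
      rw [hD, Finset.mem_filter] at hd
      refine hd.2.2 i hi h0i hid ?_
      rcases hdj.eq_or_lt with rfl | hdj
      · exact hz
      · exact hint hj h0i hid hdj hz
  refine ⟨S, D, Finset.filter_subset _ _, ?_, fun i j hij => ⟨hA i j hij, ?_⟩⟩
  · obtain ⟨d, hd, h1, -⟩ := (hfirst hd0S hM le_rfl hd0lt).1 hd0M
    exact Finset.one_lt_card.2 ⟨d0, hd0D, d, hd, h1.ne⟩
  · unfold ShapeTest
    by_cases hi : i ∈ S
    swap
    · simp only [hi, false_and, iff_false, not_not]
      by_contra h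
      exact hi (memS.2 ⟨j, h⟩)
    by_cases hj : j ∈ S
    swap
    · simp only [hj, false_and, and_false, iff_false, not_not]
      by_contra h
      exact hj (memS' h)
    have hDge : ∀ d ∈ D, d0 ≤ d := fun d hd => (Finset.mem_filter.1 hd).2.1
    simp only [hi, hj, true_and]
    rcases le_or_gt d0 i with h0i | h0i
    · rw [hfirst hi hj h0i hij]
      exact (and_iff_left ⟨d0, hd0D, Or.inl h0i⟩).symm
    · have hiM := hbefore hi h0i
      rcases lt_or_ge j d0 with h0j | h0j
      · refine iff_of_false (not_not.2 (htrans hM hiM (hsymm (hbefore hj h0j)))) ?_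
        rintro ⟨⟨d, hd, -, h1⟩, -⟩
        exact (hDge d hd).not_gt (h1.trans_lt h0j)
      · rw [and_iff_right ⟨d0, hd0D, h0i, h0j⟩]
        -- As `i` is parallel to `M`, it may be replaced by `M`, which moves the question to the
        -- range where classes are intervals.
        have e : pl A i j ≠ 0 ↔ pl A j M ≠ 0 := not_congr
          ⟨fun h => htrans hi (hsymm h) hiM, fun h => htrans hM hiM (hsymm h)⟩
        have hDM : ∀ d ∈ D, d ≤ M := fun d hd => hmax d (Finset.mem_filter.1 hd).1
        rw [e]
        rcases (hmax j hj).eq_or_lt with rfl | hjM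
        · refine iff_of_false (not_not.2 (pl_self _ _)) ?_
          rintro ⟨d, hd, h1 | h1⟩
          · exact (hDge d hd).not_gt (h1.trans_lt h0i)
          · exact (hDM d hd).not_gt h1
        · rw [hfirst hj hM h0j hjM]
          constructor
          · rintro ⟨d, hd, h1, -⟩
            exact ⟨d, hd, Or.inr h1⟩
          · rintro ⟨d, hd, h1 | h1⟩
            · exact absurd (h1.trans_lt h0i) (hDge d hd).not_gt
            · exact ⟨d, hd, h1, hDM d hd⟩

theorem exists_shape_of_nonempty {𝓑 : Set (Fin 2 ↪o Fin n)} (h : (cell 𝓑).Nonempty) :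
    ∃ S D : Finset (Fin n), D ⊆ S ∧ 2 ≤ D.card ∧ cell 𝓑 = patCell (ShapeTest S D) := by
  rw [cell_eq_patCell] at h ⊢
  obtain ⟨x, hx⟩ := h
  obtain ⟨A, -, hA⟩ := mem_patCell.1 hx
  obtain ⟨i, j, hij, hne⟩ := (rank_eq_two_iff A.1).1 A.2
  obtain ⟨S, D, hD, h2, hp⟩ := exists_shape (fun i j hij => (hA i j hij).1) ⟨i, j, hne⟩
  exact ⟨S, D, hD, h2, patCell_congr fun i j hij => (hA i j hij).2.symm.trans (hp i j hij).2⟩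

end Shape

open Diagram

/-! ## The cells of dimension five -/

/-- The pairs of columns. -/
def pairs : List (Fin 6 × Fin 6) :=
  [(0, 1), (0, 2), (0, 3), (0, 4), (0, 5), (1, 2), (1, 3), (1, 4), (1, 5), (2, 3), (2, 4), (2, 5),
    (3, 4), (3, 5), (4, 5)]

theorem mem_pairs : ∀ i j : Fin 6, i < j → (i, j) ∈ pairs := by decide

/-- The values of a predicate on the pairs of columns. -/
def code (β : Fin 6 → Fin 6 → Prop) [∀ i j, Decidable (β i j)] : List Bool :=
  pairs.map fun p => decide (β p.1 p.2)

theorem iff_of_code_eq {β β' : Fin 6 → Fin 6 → Prop} [∀ i j, Decidable (β i j)]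
    [∀ i j, Decidable (β' i j)] (h : code β = code β') {i j : Fin 6} (hij : i < j) :
    β i j ↔ β' i j := by
  have := List.map_inj_left.1 h (i, j) (mem_pairs i j hij)
  simpa using this

/-- The bases of the boundary diagram `∂_{b,v}(W)`. -/
def boundaryCode (W : Diagram 2 6) (b : Fin 2) (v : Fin 6) : List Bool :=
  if W.Touches b v (b + 1) then code fun i j => W.BasisTest i j ∧
    ¬(i = W.edgeAt b v ∧ j = W.edgeAt b v + 1 ∨ j = W.edgeAt b v ∧ i = W.edgeAt b v + 1)
  else code (W.EraseTest b v)

theorem boundaryCode_eq (W : Diagram 2 6) (b : Fin 2) (v : Fin 6) :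
    boundaryCode W b v = code (W.BoundaryTest b v) := by
  unfold boundaryCode
  split_ifs with h
  · simp only [code, BoundaryTest, h, if_true]
  · simp only [code, BoundaryTest, h, if_false]

/-- The shapes of the five-dimensional cells with at least two diagrams above them: one zero column
and one class with two elements, or three classes of which no two adjacent ones are singletons. -/
def boundaryShapes : List (Finset (Fin 6) × Finset (Fin 6)) :=
  (([0, 1, 2, 3, 4, 5] ×ˢ [0, 1, 2, 3, 4, 5] : List (Fin 6 × Fin 6)).filter
    fun x => x.1 ≠ x.2).map (fun x => (Finset.univ.erase x.1, (Finset.univ.erase x.1).erase x.2)) ++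
  [{0, 1, 3}, {0, 1, 4}, {0, 2, 3}, {0, 2, 4}, {0, 2, 5}, {0, 3, 4}, {0, 3, 5}, {1, 2, 4},
    {1, 2, 5}, {1, 3, 4}, {1, 3, 5}, {1, 4, 5}, {2, 3, 5}, {2, 4, 5}].map fun D => (Finset.univ, D)

theorem boundaryShapes_card : ∀ x ∈ boundaryShapes, x.2 ⊆ x.1 ∧ 2 ≤ x.2.card ∧
    x.1.card + x.2.card - 4 = 5 := by
  have h : (boundaryShapes.all fun x => decide (x.2 ⊆ x.1 ∧ 2 ≤ x.2.card ∧
    x.1.card + x.2.card - 4 = 5)) = true := by decide +kernel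
  simpa only [List.all_eq_true, decide_eq_true_eq] using h

/-- Killing an entry of a private column removes the column; killing an entry of a shared column
makes it parallel to the private columns of the other row; an edge minor merges two shared columns.
Outside the doubled case each of these lowers `|S| + |D|` by one, and none produces class sizes
1,1,4. -/
theorem exists_boundaryShape {W : Diagram 2 6} (hW : W ∈ diagrams) {b : Fin 2} {v : Fin 6}
    (hv : v ∈ W.support b) (hd : ¬W.Doubled b v) :
    ∃ x ∈ boundaryShapes, code (ShapeTest x.1 x.2) = boundaryCode W b v := by
  have h : (diagrams.all fun W => [0, 1].all fun b => [0, 1, 2, 3, 4, 5].all fun v =>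
      !decide (v ∈ W.support b ∧ ¬W.Doubled b v) ||
        boundaryShapes.any fun x => code (ShapeTest x.1 x.2) == boundaryCode W b v) = true := by
    decide +kernel
  have h1 := List.all_eq_true.1 (List.all_eq_true.1 (List.all_eq_true.1 h W hW) b
    (by fin_cases b <;> simp)) v (by fin_cases v <;> simp)
  simpa [hv, hd] using h1

/-- When one entry vanishes, columns with two nonzero entries remain pairwise independent, so only
two classes can have several elements. The two partitions into three pairs therefore need an edge
minor and appear as exceptional cases. -/
theorem exists_simple {x : Finset (Fin 6) × Finset (Fin 6)} (hx : x ∈ boundaryShapes) :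
    ∃ W ∈ diagrams, ∃ b, ∃ v ∈ W.support b, ((¬W.Touches b v (b + 1) ∧ ¬W.Doubled b v) ∨
      (W.prop = (diag 0 4 0 2).prop ∧ b = 0 ∧ v = 0) ∨
      (W.prop = (diag 1 5 1 3).prop ∧ b = 0 ∧ v = 1)) ∧
    code (ShapeTest x.1 x.2) = boundaryCode W b v := by
  have h : (boundaryShapes.all fun x => diagrams.any fun W => [0, 1].any fun b =>
      [0, 1, 2, 3, 4, 5].any fun v => code (ShapeTest x.1 x.2) == boundaryCode W b v &&
        decide (v ∈ W.support b) && decide ((¬W.Touches b v (b + 1) ∧ ¬W.Doubled b v) ∨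
      (W.prop = (diag 0 4 0 2).prop ∧ b = 0 ∧ v = 0) ∨
      (W.prop = (diag 1 5 1 3).prop ∧ b = 0 ∧ v = 1))) = true := by
    decide +kernel
  obtain ⟨W, hW, h1⟩ := List.any_eq_true.1 (List.all_eq_true.1 h x hx)
  obtain ⟨b, -, h1⟩ := List.any_eq_true.1 h1
  obtain ⟨v, -, h1⟩ := List.any_eq_true.1 h1
  simp only [Bool.and_eq_true, beq_iff_eq, decide_eq_true_eq] at h1
  exact ⟨W, hW, b, v, h1.1.2, h1.2, h1.1.1⟩

theorem exists_shears {x : Finset (Fin 6) × Finset (Fin 6)} (hx : x ∈ boundaryShapes) :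
    ∃ W ∈ diagrams, ∃ W' ∈ diagrams, W.prop ≠ W'.prop ∧
      (∃ T k, Shears (ShapeTest x.1 x.2) W.BasisTest T k) ∧
      ∃ T k, Shears (ShapeTest x.1 x.2) W'.BasisTest T k := by
  let f (W : Diagram 2 6) (x : Finset (Fin 6) × Finset (Fin 6)) : Bool :=
    -- This necessary condition is part of `Shears`; testing it first discards most diagrams before
    -- the search over shears.
    pairs.all (fun p => !decide (ShapeTest x.1 x.2 p.1 p.2) || decide (W.BasisTest p.1 p.2)) &&
    [0, 1, 2, 3, 4, 5].any fun s => [0, 1, 2, 3, 4, 5].any fun k =>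
      -- The sheared columns are those in the cyclic interval from `s` up to, but excluding, `k`;
      -- subtraction in `Fin 6` is cyclic.
      decide (Shears (ShapeTest x.1 x.2) W.BasisTest (x.1.filter fun a => a - s < k - s) k)
  have h : (boundaryShapes.all fun x => diagrams.any fun W => f W x && diagrams.any fun W' =>
      decide (W.prop ≠ W'.prop) && f W' x) = true := by
    decide +kernel
  obtain ⟨W, hW, h1⟩ := List.any_eq_true.1 (List.all_eq_true.1 h x hx)
  rw [Bool.and_eq_true] at h1
  obtain ⟨W', hW', h2⟩ := List.any_eq_true.1 h1.2
  rw [Bool.and_eq_true, decide_eq_true_eq] at h2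
  have hf : ∀ W, f W x = true → ∃ T k, Shears (ShapeTest x.1 x.2) W.BasisTest T k := by
    intro W h
    obtain ⟨s, -, h⟩ := List.any_eq_true.1 (Bool.and_eq_true_iff.1 h).2
    obtain ⟨k, -, h⟩ := List.any_eq_true.1 h
    exact ⟨_, k, of_decide_eq_true h⟩
  exact ⟨W, hW, W', hW', h2.1, hf W h1.1, hf W' h2.2⟩

/-- Up to the boundary shapes, a shape with three classes and no zero column lies under at most one
diagram. -/
theorem boundaryShape_or_unique_of_univ {x y z : Fin 6} (hxy : x ≠ y) (hxz : x ≠ z) (hyz : y ≠ z) :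
    (∃ s ∈ boundaryShapes, code (ShapeTest s.1 s.2) = code (ShapeTest Finset.univ {x, y, z})) ∨
      ∀ W ∈ diagrams, ∀ W' ∈ diagrams,
        (∀ i j, i < j → ShapeTest Finset.univ {x, y, z} i j → W.BasisTest i j) →
        (∀ i j, i < j → ShapeTest Finset.univ {x, y, z} i j → W'.BasisTest i j) →
        W.prop = W'.prop := by
  let le (D : Finset (Fin 6)) (W : Diagram 2 6) : Bool := pairs.all fun p =>
    !decide (ShapeTest Finset.univ D p.1 p.2) || decide (W.BasisTest p.1 p.2)
  have h : ([0, 1, 2, 3, 4, 5].all fun x => [0, 1, 2, 3, 4, 5].all fun y =>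
      [0, 1, 2, 3, 4, 5].all fun z => decide (x = y ∨ x = z ∨ y = z) ||
        (boundaryShapes.any fun s => code (ShapeTest s.1 s.2) ==
          code (ShapeTest Finset.univ {x, y, z})) ||
        diagrams.all fun W => !le {x, y, z} W || diagrams.all fun W' =>
          !le {x, y, z} W' || decide (W.prop = W'.prop)) = true := by
    decide +kernel
  have hmem : ∀ x : Fin 6, x ∈ [0, 1, 2, 3, 4, 5] := by decide
  have h1 := List.all_eq_true.1 (List.all_eq_true.1 (List.all_eq_true.1 h x (hmem x)) y (hmem y)) z
    (hmem z)
  simp only [hxy, hxz, hyz, or_self, decide_false, Bool.false_or, Bool.or_eq_true, List.any_eq_true,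
    beq_iff_eq] at h1
  refine h1.imp id fun h2 W hW W' hW' hle hle' => ?_
  have hle1 : ∀ W : Diagram 2 6, (∀ i j, i < j → ShapeTest Finset.univ {x, y, z} i j →
      W.BasisTest i j) → le {x, y, z} W = true := by
    intro W h
    rw [List.all_eq_true]
    intro p hp
    have : p.1 < p.2 := (by decide : ∀ p ∈ pairs, p.1 < p.2) p hp
    by_cases h3 : ShapeTest Finset.univ {x, y, z} p.1 p.2
    · simp [h3, h _ _ this h3]
    · simp [h3]
  have h3 := List.all_eq_true.1 h2 W hW
  rw [hle1 W hle, Bool.not_true, Bool.false_or] at h3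
  have h4 := List.all_eq_true.1 h3 W' hW'
  rw [hle1 W' hle', Bool.not_true, Bool.false_or] at h4
  exact of_decide_eq_true h4

theorem boundaryShape_or_unique {S D : Finset (Fin 6)} (hD : D ⊆ S)
    (h : S.card + D.card - 4 = 5) :
    (∃ s ∈ boundaryShapes, code (ShapeTest s.1 s.2) = code (ShapeTest S D)) ∨
      ∀ W ∈ diagrams, ∀ W' ∈ diagrams,
        (∀ i j, i < j → ShapeTest S D i j → W.BasisTest i j) →
        (∀ i j, i < j → ShapeTest S D i j → W'.BasisTest i j) → W.prop = W'.prop := by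
  have h1 : S.card ≤ 6 := by simpa using S.card_le_univ
  have h2 := Finset.card_le_card hD
  -- `|S| + |D| = 9` with `|D| ≤ |S| ≤ 6` leaves `6 + 3` and `5 + 4`. In the second case one zero
  -- column and one element of `S` outside `D` determine the shape, and all thirty choices are
  -- listed.
  rcases (show S.card = 6 ∨ S.card = 5 by omega) with h6 | h5
  · have hS : S = Finset.univ := Finset.card_eq_iff_eq_univ S |>.1 (by simpa using h6)
    obtain ⟨x, y, z, hxy, hxz, hyz, rfl⟩ := Finset.card_eq_three.1 (show D.card = 3 by omega)
    subst hS
    exact boundaryShape_or_unique_of_univ hxy hxz hyz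
  · left
    obtain ⟨l, hl⟩ := Finset.card_eq_one.1 (show Sᶜ.card = 1 by
      rw [Finset.card_compl, h5]; rfl)
    have hS : S = Finset.univ.erase l := by
      ext a
      have : a ∈ Sᶜ ↔ a = l := by rw [hl, Finset.mem_singleton]
      rw [Finset.mem_compl] at this
      simp only [Finset.mem_erase, Finset.mem_univ, and_true]
      tauto
    obtain ⟨d, hd⟩ := Finset.card_eq_one.1 (show (S \ D).card = 1 by
      rw [Finset.card_sdiff_of_subset hD]; omega)
    have hdS : d ∈ S \ D := by rw [hd]; exact Finset.mem_singleton_self d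
    have hDd : D = S.erase d := by
      ext a
      have h3 : a ∈ S \ D ↔ a = d := by rw [hd, Finset.mem_singleton]
      rw [Finset.mem_sdiff] at h3
      rw [Finset.mem_erase]
      have := @hD a
      tauto
    refine ⟨(S, D), ?_, rfl⟩
    rw [hDd, hS, boundaryShapes, List.mem_append]
    left
    rw [List.mem_map]
    refine ⟨(l, d), ?_, rfl⟩
    have hne : l ≠ d := by
      rintro rfl
      rw [Finset.mem_sdiff, hS] at hdS
      exact Finset.notMem_erase _ _ hdS.1
    rw [List.mem_filter]
    refine ⟨?_, by simpa using hne⟩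
    have hmem : ∀ l d : Fin 6,
        (l, d) ∈ ([0, 1, 2, 3, 4, 5] ×ˢ [0, 1, 2, 3, 4, 5] : List (Fin 6 × Fin 6)) := by decide
    exact hmem l d

/-! ## The main theorem -/

theorem Diagram.sig_eq (W : Diagram 2 6) : W.Sig = closure (patCell W.BasisTest) := by
  rw [Sig, patCell]
  congr 2
  ext I
  exact W.mem_bases_iff I

theorem Diagram.boundaryCell_eq (W : Diagram 2 6) (b : Fin 2) (v : Fin 6) :
    W.boundaryCell b v = patCell (W.BoundaryTest b v) := by
  rw [boundaryCell, patCell]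
  congr 1
  ext I
  exact W.minor_boundaryMat_ne_zero_iff b v I

theorem boundaryCell_eq_of_code {W : Diagram 2 6} {b : Fin 2} {v : Fin 6} {S D : Finset (Fin 6)}
    (h : code (ShapeTest S D) = boundaryCode W b v) :
    W.boundaryCell b v = patCell (ShapeTest S D) := by
  rw [W.boundaryCell_eq]
  rw [boundaryCode_eq] at h
  exact patCell_congr fun i j hij => (iff_of_code_eq h hij).symm

/-- The five-dimensional positroid cells with at least two diagrams above them. -/
theorem shared_iff (B : Set (Grassmannian 2 6)) :
    (IsPositroidCell B ∧ HasDimension B 5 ∧ B ⊆ wilsonSpace 2 6 ∧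
      ∃ W W' : Diagram 2 6, W.Admissible ∧ W'.Admissible ∧ W ≠ W' ∧ B ⊆ W.Sig ∩ W'.Sig) ↔
    ∃ s ∈ boundaryShapes, B = patCell (ShapeTest s.1 s.2) := by
  constructor
  · rintro ⟨⟨hne, 𝓑, rfl⟩, hdim, -, W, W', hW, hW', hWW', hsub⟩
    obtain ⟨S, D, hD, h2, hB⟩ := exists_shape_of_nonempty hne
    rw [hB] at hne hdim hsub ⊢
    have hle : ∀ W : Diagram 2 6, patCell (ShapeTest S D) ⊆ W.Sig →
        ∀ i j, i < j → ShapeTest S D i j → W.BasisTest i j := by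
      intro W h i j hij
      rw [W.sig_eq] at h
      exact pattern_le_of_subset_closure hne h hij
    rcases boundaryShape_or_unique hD ((hasDimension_shape hD h2).eq hdim) with ⟨s, hs, hc⟩ | h
    · exact ⟨s, hs, patCell_congr fun i j hij => (iff_of_code_eq hc hij).symm⟩
    · exact absurd (Diagram.ext (h W (mem_diagrams W hW) W' (mem_diagrams W' hW')
        (hle W fun x hx => (hsub hx).1) (hle W' fun x hx => (hsub hx).2))) hWW'
  · rintro ⟨s, hs, rfl⟩
    obtain ⟨hD, h2, h5⟩ := boundaryShapes_card s hs
    obtain ⟨W, hW, W', hW', hne, ⟨T, k, hT⟩, T', k', hT'⟩ := exists_shears hs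
    have h1 : patCell (ShapeTest s.1 s.2) ⊆ W.Sig := by
      rw [W.sig_eq]; exact patCell_subset_closure_of_shears hT
    have h1' : patCell (ShapeTest s.1 s.2) ⊆ W'.Sig := by
      rw [W'.sig_eq]; exact patCell_subset_closure_of_shears hT'
    refine ⟨⟨patCell_shape_nonempty hD h2, _, rfl⟩, h5 ▸ hasDimension_shape hD h2, ?_, W, W',
      diagrams_admissible W hW, diagrams_admissible W' hW', fun h => hne (by rw [h]),
      Set.subset_inter h1 h1'⟩
    exact fun x hx => Set.mem_iUnion₂.2 ⟨W, diagrams_admissible W hW, subset_closure (h1 hx)⟩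

/-- Only the absence of doubling is extracted from the pole, so the weaker notion suffices and the
poles along edge minors need no analysis in this direction. -/
theorem exists_boundaryShape_of_pole {W : Diagram 2 6} (hW : W.Admissible) {b : Fin 2} {v : Fin 6}
    (hv : v ∈ W.support b) (h : W.IsSimplePoleOnComponent b v) :
    ∃ s ∈ boundaryShapes, W.boundaryCell b v = patCell (ShapeTest s.1 s.2) := by
  have hW := mem_diagrams W hW
  have hd : ¬W.Doubled b v := fun hd => not_isSimplePoleOnComponent_of_doubled hW hv hd h
  obtain ⟨s, hs, hc⟩ := exists_boundaryShape hW hv hd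
  exact ⟨s, hs, boundaryCell_eq_of_code hc⟩

theorem exists_pole_of_boundaryShape {s : Finset (Fin 6) × Finset (Fin 6)}
    (hs : s ∈ boundaryShapes) : ∃ W : Diagram 2 6, W.Admissible ∧ ∃ b : Fin 2, ∃ v ∈ W.support b,
      patCell (ShapeTest s.1 s.2) = W.boundaryCell b v ∧ W.IsSimplePole b v := by
  obtain ⟨W, hW, b, v, hv, h, hc⟩ := exists_simple hs
  refine ⟨W, diagrams_admissible W hW, b, v, hv, (boundaryCell_eq_of_code hc).symm, ?_⟩
  rcases h with ⟨h1, h2⟩ | ⟨h1, rfl, rfl⟩ | ⟨h1, rfl, rfl⟩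
  · exact isSimplePole_entry hW hv h1 h2
  · obtain rfl : W = diag 0 4 0 2 := Diagram.ext h1
    exact isSimplePole_edge_even
  · obtain rfl : W = diag 1 5 1 3 := Diagram.ext h1
    exact isSimplePole_edge_odd

end WilsonLoop

theorem mainTheorem2 (B : Set (WilsonLoop.Grassmannian 2 6)) :
    ((WilsonLoop.IsPositroidCell B ∧ WilsonLoop.HasDimension B 5 ∧
        B ⊆ WilsonLoop.wilsonSpace 2 6 ∧
        ∃ W W' : WilsonLoop.Diagram 2 6, W.Admissible ∧ W'.Admissible ∧ W ≠ W' ∧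
          B ⊆ W.Sig ∩ W'.Sig) ↔
      ∃ W : WilsonLoop.Diagram 2 6, W.Admissible ∧ ∃ b : Fin 2, ∃ v ∈ W.support b,
        B = W.boundaryCell b v ∧ W.IsSimplePole b v) ∧
    ((WilsonLoop.IsPositroidCell B ∧ WilsonLoop.HasDimension B 5 ∧
        B ⊆ WilsonLoop.wilsonSpace 2 6 ∧
        ∃ W W' : WilsonLoop.Diagram 2 6, W.Admissible ∧ W'.Admissible ∧ W ≠ W' ∧
          B ⊆ W.Sig ∩ W'.Sig) ↔
      ∃ W : WilsonLoop.Diagram 2 6, W.Admissible ∧ ∃ b : Fin 2, ∃ v ∈ W.support b,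
        B = W.boundaryCell b v ∧ W.IsSimplePoleOnComponent b v) := by
  rw [WilsonLoop.shared_iff]
  constructor
  · constructor
    · rintro ⟨s, hs, rfl⟩
      exact WilsonLoop.exists_pole_of_boundaryShape hs
    · rintro ⟨W, hW, b, v, hv, rfl, h⟩
      exact WilsonLoop.exists_boundaryShape_of_pole hW hv h.onComponent
  · constructor
    · rintro ⟨s, hs, rfl⟩
      obtain ⟨W, hW, b, v, hv, hB, h⟩ := WilsonLoop.exists_pole_of_boundaryShape hs
      exact ⟨W, hW, b, v, hv, hB, h.onComponent⟩
    · rintro ⟨W, hW, b, v, hv, rfl, h⟩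
      exact WilsonLoop.exists_boundaryShape_of_pole hW hv h
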